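/- Let $\mathcal H\neq\{0\}$ be a finite-dimensional complex Hilbert space, let $X=\mathcal I_1(\mathcal H)$ be the space of all operators on $\mathcal H$ with the trace norm $\|\eta\|_1=\operatorname{Tr}\big((\eta^*\eta)^{1/2}\big)$, and let $\|\cdot\|$ be the induced operator norm on $\mathcal B(X)$. Let $S^1\subset\mathbb C$ be the unit circle. A linear map on $X$ is CPTP if it is completely positive and trace preserving; it is irreducible if the only orthogonal projections $p$ of $\mathcal H$ for which it maps $pXp$ into itself are $p=0$ and $p=\mathrm{Id}$. For $A\in\mathcal B(X)$ and $e\in\operatorname{sp}A$, let $P_{e,A}=\frac1{2\pi i}\oint(z-A)^{-1}\,dz$ be the spectral projector of $A$ on $\{e\}$, where the integral is over a circle around $e$ enclosing no other point of $\operatorname{sp}A$. Put $P_A=\sum_{e\in\operatorname{sp}A\cap S^1}P_{e,A}$ and $Q_A=\mathrm{Id}-P_A$. For a map $s\mapsto\mathcal L(s)\in\mathcal B(X)$ on $[0,1]$ write $P(s)=P_{\mathcal L(s)}$ and $Q(s)=Q_{\mathcal L(s)}$, and consider the following conditions ($C^2$ on $[0,1]$ is understood with one-sided derivatives at the end points):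 - **H1.** $\|\mathcal L(s)\|\le 1$ for every $s\in[0,1]$. - **H2.** There is $\epsilon>0$ such that for every $s\in[0,1]$ each $e\in\operatorname{sp}\mathcal L(s)\cap S^1$ is a simple eigenvalue (algebraic multiplicity one), and $|e-e'|>2\epsilon$ for all $e\ne e'$ in $\operatorname{sp}\mathcal L(s)\cap S^1$. - **H3.** The map $s\mapsto\mathcal L(s)P(s)$ is $C^2$ on $[0,1]$. - **H4.** $\sup_{s\in[0,1]}\|\mathcal L(s)Q(s)\|<1$. - **wH4.** $\ell':=\sup_{s\in[0,1]}\operatorname{spr}\big(\mathcal L(s)Q(s)\big)<1$, where $\operatorname{spr}$ is the spectral radius. **Proposition.** Let $s\mapsto\mathcal L(s)\in\mathcal B(X)$ be $C^2$ on $[0,1]$, with each $\mathcal L(s)$ an irreducible CPTP map. 1. If $s\mapsto\mathcal L(s)$ satisfies H4, then it satisfies H1, H2, H3 and H4. 2. If $s\mapsto\mathcal L(s)$ satisfies wH4, then for every $\ell\in(\ell',1)$ there is an integer $m\ge1$ such that $s\mapsto\mathcal L(s)^m$ satisfies H1, H2, H3 and H4, with $\sup_{s\in[0,1]}\|\mathcal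 L(s)^mQ_{\mathcal L(s)^m}\|\le\ell$. 3. If $s\mapsto\mathcal L(s)$ satisfies H4 or wH4, then there is an integer $z\ge1$ such that for all $s\in[0,1]$ $$\operatorname{sp}\mathcal L(s)\cap S^1=S_z:=\{\exp(2\pi i k/z): k=0,1,\dots,z-1\}.$$ -/

import Mathlib

open Set Filter Topology

noncomputable section

section TraceNorm

variable {H : Type*} [NormedAddCommGroup H] [InnerProductSpace ℂ H] [CompleteSpace H]

/-- The trace norm `Tr ((A* A)^(1/2))` of an operator on a finite-dimensional Hilbert space. -/
def traceNorm (A : H →L[ℂ] H) : ℝ :=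
  (LinearMap.trace ℂ H (CFC.abs A).toLinearMap).re

variable [FiniteDimensional ℂ H]

/-- An orthonormal eigenbasis of `|A|`: it exhibits the trace norm as the sum of the singular
values of `A`. -/
theorem exists_basis_traceNorm (A : H →L[ℂ] H) :
    ∃ (b : OrthonormalBasis (Fin (Module.finrank ℂ H)) ℂ H) (σ : Fin (Module.finrank ℂ H) → ℝ),
      (∀ i, 0 ≤ σ i) ∧ (∀ i j, inner ℂ (A (b i)) (A (b j)) = if i = j then (σ i : ℂ) ^ 2 else 0) ∧
      (∀ i, ‖A (b i)‖ = σ i) ∧ traceNorm A = ∑ i, σ i := by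
  have hpos : (CFC.abs A).IsPositive :=
    (ContinuousLinearMap.nonneg_iff_isPositive _).1 (CFC.abs_nonneg A)
  have hsym : (CFC.abs A).toLinearMap.IsSymmetric := hpos.isSymmetric
  set b := hsym.eigenvectorBasis rfl with hb
  set σ := hsym.eigenvalues rfl with hσ
  have hbσ : ∀ i, CFC.abs A (b i) = (σ i : ℂ) • b i := fun i =>
    hsym.apply_eigenvectorBasis rfl i
  have hσ0 : ∀ i, 0 ≤ σ i := by
    intro i
    have h := hpos.re_inner_nonneg_right (b i)
    rw [hbσ, inner_smul_right, inner_self_eq_norm_sq_to_K, b.norm_eq_one] at h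
    simpa using h
  have hinner : ∀ i j, inner ℂ (A (b i)) (A (b j)) = if i = j then (σ i : ℂ) ^ 2 else 0 := by
    intro i j
    have h1 : inner ℂ (A (b i)) (A (b j)) = inner ℂ (b i) ((star A * A) (b j)) := by
      change _ = inner ℂ (b i) (star A (A (b j)))
      rw [ContinuousLinearMap.star_eq_adjoint, ContinuousLinearMap.adjoint_inner_right]
    rw [h1, ← CFC.abs_mul_abs]
    change inner ℂ (b i) (CFC.abs A (CFC.abs A (b j))) = _
    rw [hbσ, map_smul, hbσ, inner_smul_right, inner_smul_right, orthonormal_iff_ite.1 b.orthonormal]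
    by_cases hij : i = j
    · subst hij; simp [sq]
    · simp [hij]
  refine ⟨b, σ, hσ0, hinner, fun i => ?_, ?_⟩
  · have h := hinner i i
    rw [inner_self_eq_norm_sq_to_K, if_pos rfl] at h
    have h' : ‖A (b i)‖ ^ 2 = σ i ^ 2 := by
      rw [← Complex.ofReal_inj, Complex.ofReal_pow, Complex.ofReal_pow]
      exact h
    exact (pow_left_inj₀ (norm_nonneg _) (hσ0 i) two_ne_zero).1 h'
  · rw [traceNorm, hsym.trace_eq_sum_eigenvalues rfl]
    simp [hσ]

/-- A contraction pairs with `A` to at most the trace norm of `A`. -/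
theorem re_trace_mul_le_traceNorm (W A : H →L[ℂ] H) (hW : ∀ x, ‖W x‖ ≤ ‖x‖) :
    (LinearMap.trace ℂ H (W * A).toLinearMap).re ≤ traceNorm A := by
  obtain ⟨b, σ, -, -, hn, ht⟩ := exists_basis_traceNorm A
  rw [LinearMap.trace_eq_sum_inner _ b, Complex.re_sum, ht]
  refine Finset.sum_le_sum fun i _ => ?_
  calc (inner ℂ (b i) (W (A (b i)))).re ≤ ‖inner ℂ (b i) (W (A (b i)))‖ := Complex.re_le_norm _
    _ ≤ ‖b i‖ * ‖W (A (b i))‖ := norm_inner_le_norm _ _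
    _ ≤ 1 * ‖A (b i)‖ := by rw [b.norm_eq_one]; gcongr; exact hW _
    _ = σ i := by rw [one_mul, hn]

/-- The trace norm is attained by pairing with a contraction. -/
theorem exists_contraction_traceNorm (A : H →L[ℂ] H) :
    ∃ W : H →L[ℂ] H, (∀ x, ‖W x‖ ≤ ‖x‖) ∧
      traceNorm A = (LinearMap.trace ℂ H (W * A).toLinearMap).re := by
  obtain ⟨b, σ, h0, hin, hn, ht⟩ := exists_basis_traceNorm A
  let W : H →L[ℂ] H := ∑ i, ((σ i)⁻¹ : ℂ) • (innerSL ℂ (A (b i))).smulRight (b i)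
  have hWx : ∀ x, W x = ∑ i, (((σ i)⁻¹ : ℂ) * inner ℂ (A (b i)) x) • b i := by
    intro x
    simp [W, smul_smul]
  refine ⟨W, fun x => ?_, ?_⟩
  · let v : {i // σ i ≠ 0} → H := fun i => ((σ i)⁻¹ : ℂ) • A (b i)
    have hv : Orthonormal ℂ v := by
      rw [orthonormal_iff_ite]
      intro i j
      simp only [v, inner_smul_left, inner_smul_right, hin, Subtype.ext_iff]
      by_cases hij : i.1 = j.1
      · have hi : (σ j : ℂ) ≠ 0 := by exact_mod_cast j.2
        simp [hij]
        field_simp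
      · simp [hij]
    have hsq : ‖W x‖ ^ 2 = ∑ i, ‖((σ i)⁻¹ : ℂ) * inner ℂ (A (b i)) x‖ ^ 2 := by
      rw [hWx, ← b.sum_sq_norm_inner_right]
      refine Finset.sum_congr rfl fun i _ => ?_
      rw [inner_sum, Finset.sum_eq_single i]
      · simp [inner_smul_right]
      · intro j _ hj
        rw [inner_smul_right, orthonormal_iff_ite.1 b.orthonormal, if_neg (Ne.symm hj), mul_zero]
      · simp
    have hle : ‖W x‖ ^ 2 ≤ ‖x‖ ^ 2 := by
      rw [hsq]
      refine le_trans (le_of_eq ?_) (hv.sum_inner_products_le x (s := Finset.univ))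
      have hs : ∑ i : {i // σ i ≠ 0}, ‖inner ℂ (v i) x‖ ^ 2
          = ∑ i ∈ Finset.univ.filter (fun i => σ i ≠ 0),
            ‖((σ i)⁻¹ : ℂ) * inner ℂ (A (b i)) x‖ ^ 2 := by
        rw [← Finset.sum_subtype_eq_sum_filter, Finset.subtype_univ]
        refine Finset.sum_congr rfl fun i _ => ?_
        simp [v, mul_comm]
      rw [hs, Finset.sum_filter_of_ne]
      intro i _ hi h
      simp [h] at hi
    exact (pow_le_pow_iff_left₀ (norm_nonneg _) (norm_nonneg _) two_ne_zero).1 hle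
  · rw [LinearMap.trace_eq_sum_inner _ b, ht, Complex.re_sum]
    refine Finset.sum_congr rfl fun i _ => ?_
    change σ i = (inner ℂ (b i) (W (A (b i)))).re
    rw [hWx, Finset.sum_eq_single i]
    · rw [hin, if_pos rfl, inner_smul_right, inner_self_eq_norm_sq_to_K, b.norm_eq_one]
      by_cases hi : σ i = 0
      · simp [hi]
      · have hi' : (σ i : ℂ) ≠ 0 := by exact_mod_cast hi
        have : ((σ i)⁻¹ : ℂ) * (σ i : ℂ) ^ 2 = σ i := by field_simp
        rw [this]
        simp
    · intro j _ hj
      rw [hin, if_neg hj]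
      simp
    · simp

end TraceNorm

/-- The Banach space `I₁(H)` of trace-class operators on a finite-dimensional Hilbert space `H`
(that is, of all operators on `H`), to be normed by the trace norm. -/
def TraceClass (H : Type*) [NormedAddCommGroup H] [InnerProductSpace ℂ H] : Type _ :=
  H →L[ℂ] H

namespace TraceClass

variable {H : Type*} [NormedAddCommGroup H] [InnerProductSpace ℂ H]

instance : AddCommGroup (TraceClass H) := inferInstanceAs (AddCommGroup (H →L[ℂ] H))

instance : Module ℂ (TraceClass H) := inferInstanceAs (Module ℂ (H →L[ℂ] H))

/-- The identity map from `I₁(H)` to the operators on `H`. -/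
def toOp : TraceClass H ≃ₗ[ℂ] (H →L[ℂ] H) := LinearEquiv.refl ℂ (H →L[ℂ] H)

instance [FiniteDimensional ℂ H] : FiniteDimensional ℂ (TraceClass H) :=
  inferInstanceAs (FiniteDimensional ℂ (H →L[ℂ] H))

variable [CompleteSpace H]

instance : Norm (TraceClass H) := ⟨fun A => traceNorm (toOp A)⟩

theorem norm_def (A : TraceClass H) : ‖A‖ = traceNorm (toOp A) := rfl

variable [FiniteDimensional ℂ H]

theorem normCore : NormedSpace.Core ℂ (TraceClass H) where
  norm_nonneg A := by
    obtain ⟨b, σ, h0, -, -, ht⟩ := exists_basis_traceNorm (toOp A)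
    rw [norm_def, ht]
    exact Finset.sum_nonneg fun i _ => h0 i
  norm_smul c A := by
    rw [norm_def, norm_def, map_smul, traceNorm, traceNorm, CFC.abs_smul]
    have : ((‖c‖ • CFC.abs (toOp A) : H →L[ℂ] H) : H →ₗ[ℂ] H)
        = (‖c‖ : ℂ) • (CFC.abs (toOp A) : H →L[ℂ] H).toLinearMap := by
      ext x
      simp
    rw [this, map_smul, smul_eq_mul, Complex.re_ofReal_mul]
  norm_triangle A B := by
    obtain ⟨W, hW, ht⟩ := exists_contraction_traceNorm (toOp (A + B))
    rw [norm_def, ht, map_add, mul_add, ContinuousLinearMap.toLinearMap_add, map_add,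
      Complex.add_re]
    exact add_le_add (re_trace_mul_le_traceNorm W _ hW) (re_trace_mul_le_traceNorm W _ hW)
  norm_eq_zero_iff A := by
    constructor
    · intro h
      obtain ⟨b, σ, h0, -, hn, ht⟩ := exists_basis_traceNorm (toOp A)
      rw [norm_def, ht, Finset.sum_eq_zero_iff_of_nonneg fun i _ => h0 i] at h
      apply toOp.injective
      rw [map_zero]
      have hz : (toOp A).toLinearMap = 0 := by
        refine b.toBasis.ext fun i => ?_
        have := hn i
        rw [h i (Finset.mem_univ i), norm_eq_zero] at this
        simpa using this
      ext x
      exact LinearMap.congr_fun hz x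
    · rintro rfl
      rw [norm_def, map_zero, traceNorm, CFC.abs_zero]
      simp

instance : NormedAddCommGroup (TraceClass H) := NormedAddCommGroup.ofCore normCore

instance : NormedSpace ℂ (TraceClass H) := NormedSpace.ofCore normCore

end TraceClass

section Channels

variable {H : Type*} [NormedAddCommGroup H] [InnerProductSpace ℂ H] [CompleteSpace H]
  [FiniteDimensional ℂ H]

/-- Completely positive and trace preserving maps on `I₁(H)`. Complete positivity is that of maps
of the C*-algebra of all operators on `H`. -/
def IsCPTP (Φ : TraceClass H →L[ℂ] TraceClass H) : Prop :=
  (∃ φ : CompletelyPositiveMap (H →L[ℂ] H) (H →L[ℂ] H),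
      ∀ A : TraceClass H, (Φ A).toOp = φ A.toOp) ∧
    ∀ A : TraceClass H,
      LinearMap.trace ℂ H (Φ A).toOp.toLinearMap = LinearMap.trace ℂ H A.toOp.toLinearMap

/-- `Φ` is irreducible: the only orthogonal projections `p` of `H` for which `Φ` maps
`p I₁(H) p` into itself are `0` and the identity. -/
def IsIrreducibleMap (Φ : TraceClass H →L[ℂ] TraceClass H) : Prop :=
  ∀ p : H →L[ℂ] H, IsStarProjection p →
    (∀ A : H →L[ℂ] H, ∃ B : H →L[ℂ] H,
      (Φ (TraceClass.toOp.symm (p * A * p))).toOp = p * B * p) →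
    p = 0 ∨ p = 1

end Channels

section Spectral

variable {X : Type*} [NormedAddCommGroup X] [NormedSpace ℂ X] [FiniteDimensional ℂ X]

/-- The peripheral spectrum: the part of the spectrum on the unit circle. -/
def peripheralSpectrum (A : X →L[ℂ] X) : Set ℂ :=
  spectrum ℂ A ∩ Metric.sphere 0 1

/-- The spectral projector of `A` on `{e}`, that is `(2πi)⁻¹ ∮ (z - A)⁻¹ dz` over any circle
around `e` that is small enough to enclose no other point of the spectrum. The integral does not
depend on the radius of such a circle, so the limit is taken of an eventually constant function. -/
def spectralProjector (A : X →L[ℂ] X) (e : ℂ) : X →L[ℂ] X :=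
  limUnder (𝓝[>] (0 : ℝ)) fun r : ℝ =>
    (2 * Real.pi * Complex.I : ℂ)⁻¹ • ∮ z in C(e, r), resolvent A z

/-- The peripheral spectral projector: the sum of the spectral projectors over the (finitely many)
peripheral eigenvalues. -/
def peripheralProjector (A : X →L[ℂ] X) : X →L[ℂ] X :=
  ∑ᶠ e ∈ peripheralSpectrum A, spectralProjector A e

/-- The peripheral part of `A`. -/
def peripheralPart (A : X →L[ℂ] X) : X →L[ℂ] X :=
  A * peripheralProjector A

/-- The complementary, strictly contracting part of `A`. -/
def nonperipheralPart (A : X →L[ℂ] X) : X →L[ℂ] X :=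
  A * (1 - peripheralProjector A)

/-- The eigenvalue `e` of `A` is simple: its algebraic multiplicity is one. -/
def IsSimpleEigenvalue (A : X →L[ℂ] X) (e : ℂ) : Prop :=
  Module.finrank ℂ (Module.End.maxGenEigenspace A.toLinearMap e) = 1

/-- `C²` on `[0,1]` (with one-sided derivatives at the end points; equivalently, continuous on
`[0,1]`, `C²` on `(0,1)`, the first two derivatives having limits at `0` and `1`). -/
def IsC2 {E : Type*} [NormedAddCommGroup E] [NormedSpace ℝ E] (f : ℝ → E) : Prop :=
  ContDiffOn ℝ 2 f (Icc 0 1)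

/-- Every `L(s)` is a contraction. -/
def IsContractive (L : ℝ → X →L[ℂ] X) : Prop :=
  ∀ s ∈ Icc (0 : ℝ) 1, ‖L s‖ ≤ 1

/-- The peripheral eigenvalues are simple, with a gap between them that is uniform in `s`. -/
def HasPeripheralGap (L : ℝ → X →L[ℂ] X) : Prop :=
  ∃ ε : ℝ, 0 < ε ∧ ∀ s ∈ Icc (0 : ℝ) 1,
    (∀ e ∈ peripheralSpectrum (L s), IsSimpleEigenvalue (L s) e) ∧
    ∀ e ∈ peripheralSpectrum (L s), ∀ e' ∈ peripheralSpectrum (L s), e ≠ e' → 2 * ε < ‖e - e'‖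

/-- The peripheral part of `L(s)` is a `C²` function of `s`. -/
def HasC2PeripheralPart (L : ℝ → X →L[ℂ] X) : Prop :=
  IsC2 fun s => peripheralPart (L s)

/-- The supremum over `s` of the norms of the strictly contracting parts, in `[0,∞]`. -/
def nonperipheralNorm (L : ℝ → X →L[ℂ] X) : ENNReal :=
  ⨆ s ∈ Icc (0 : ℝ) 1, ‖nonperipheralPart (L s)‖ₑ

/-- The supremum over `s` of the spectral radii of the strictly contracting parts, in `[0,∞]`. -/
def nonperipheralSpectralRadius (L : ℝ → X →L[ℂ] X) : ENNReal :=
  ⨆ s ∈ Icc (0 : ℝ) 1, spectralRadius ℂ (nonperipheralPart (L s))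

/-- The uniform norm bound on the strictly contracting part. -/
def HasNormBound (L : ℝ → X →L[ℂ] X) : Prop :=
  nonperipheralNorm L < 1

/-- The uniform spectral bound on the strictly contracting part. -/
def HasSpectralBound (L : ℝ → X →L[ℂ] X) : Prop :=
  nonperipheralSpectralRadius L < 1

/-- The four standing conditions of the adiabatic theory together. -/
def IsAdiabatic (L : ℝ → X →L[ℂ] X) : Prop :=
  IsContractive L ∧ HasPeripheralGap L ∧ HasC2PeripheralPart L ∧ HasNormBound L

end Spectral

/-- The set `S_z` of the `z`-th roots of unity. -/
def unitRoots (z : ℕ) : Set ℂ :=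
  {w | ∃ k : ℕ, k < z ∧ w = Complex.exp (2 * Complex.I * Real.pi * k / z)}

end

/-
A channel is a contraction for the trace norm, so its peripheral eigenvalues are semisimple. In the
trace pairing a left eigenvector for a peripheral eigenvalue `e` is an operator `u` with
`∑ i, Kᵢ* u Kᵢ = e u`, where the `Kᵢ` are Kraus operators. As `∑ i, Kᵢ* Kᵢ = 1`,
`∑ i, ‖e Kᵢ u x - u Kᵢ x‖² = ∑ i, ‖u Kᵢ x‖² - ‖u x‖²`,
and the right-hand side is at most `0` where `u` attains its norm. The vectors where it does form an
invariant subspace, hence all of `H`, and so `u Kᵢ = e Kᵢ u`. By irreducibility such intertwiners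
are invertible and unique up to a scalar, and they multiply: peripheral eigenvalues are simple and
form a finite group, i.e. some `S_z` with `z` at most the dimension.

Along the family, the peripheral spectrum thus takes values in a fixed finite set, and a spectral
bound keeps the remaining eigenvalues away from the circle. For `e` on the circle, `|det (e - L s)|`
is then either `0` or bounded below, so by continuity the peripheral spectrum is constant. The
projector on a simple eigenvalue `e` is a rational expression in `L s`, hence `C²`. For the powers
take `m ≡ 1 mod z`, so that `e ↦ e ^ m` fixes the peripheral spectrum, and `m` large: the powers of
`L(s) Q(s)` tend to `0` for each `s`, and uniformly by Dini's theorem.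
-/

noncomputable section

section FiniteDimensional

variable {X : Type*} [NormedAddCommGroup X] [NormedSpace ℂ X] [FiniteDimensional ℂ X]

theorem isUnit_of_forall_apply_eq_zero {A : X →L[ℂ] X} (h : ∀ x, A x = 0 → x = 0) : IsUnit A := by
  have := FiniteDimensional.complete ℂ X
  rw [ContinuousLinearMap.isUnit_iff_isUnit_toLinearMap, LinearMap.isUnit_iff_ker_eq_bot,
    LinearMap.ker_eq_bot']
  exact h

theorem ringInverse_eq_of_mul_eq_one {A B : X →L[ℂ] X} (h : B * A = 1) : Ring.inverse A = B := by
  have hA : IsUnit A := isUnit_of_forall_apply_eq_zero fun x hx => by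
    rw [← one_apply_eq_self (F := X →L[ℂ] X) x, ← h, mul_apply_eq_comp, hx, map_zero]
  rw [← one_mul (Ring.inverse A), ← h, Ring.mul_inverse_cancel_right _ _ hA]

theorem mem_spectrum_iff_exists_eigenvector {A : X →L[ℂ] X} {e : ℂ} :
    e ∈ spectrum ℂ A ↔ ∃ x, x ≠ 0 ∧ A x = e • x := by
  have := FiniteDimensional.complete ℂ X
  rw [ContinuousLinearMap.spectrum_eq, ← Module.End.hasEigenvalue_iff_mem_spectrum]
  constructor
  · intro h
    obtain ⟨x, hx⟩ := h.exists_hasEigenvector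
    exact ⟨x, hx.2, hx.apply_eq_smul⟩
  · rintro ⟨x, hx, hAx⟩
    exact Module.End.hasEigenvalue_of_hasEigenvector ⟨Module.End.mem_eigenspace_iff.2 hAx, hx⟩

theorem mem_spectrum_iff_exists_functional {A : X →L[ℂ] X} {e : ℂ} :
    e ∈ spectrum ℂ A ↔ ∃ g : X →ₗ[ℂ] ℂ, g ≠ 0 ∧ ∀ x, g (A x) = e * g x := by
  have := FiniteDimensional.complete ℂ X
  rw [ContinuousLinearMap.spectrum_eq, spectrum.mem_iff, LinearMap.isUnit_iff_range_eq_top]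
  constructor
  · intro h
    obtain ⟨x, -, hx⟩ := SetLike.exists_of_lt (lt_top_iff_ne_top.2 h)
    obtain ⟨g, hgx, hg⟩ := Submodule.exists_le_ker_of_notMem hx
    refine ⟨g, ne_of_apply_ne (· x) hgx, fun y => (sub_eq_zero.1 ?_).symm⟩
    rw [← smul_eq_mul, ← map_smul, ← map_sub]
    exact hg ⟨y, rfl⟩
  · rintro ⟨g, hg0, hg⟩ htop
    refine hg0 (LinearMap.ext fun x => ?_)
    obtain ⟨y, rfl⟩ := LinearMap.range_eq_top.1 htop x
    change g (e • y - A y) = 0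
    rw [map_sub, map_smul, hg, smul_eq_mul, sub_self]

end FiniteDimensional

section SemisimpleEigenvalue

variable {X : Type*} [NormedAddCommGroup X] [NormedSpace ℂ X]

/-- The eigenvalue `e` of `A` is semisimple: its algebraic and geometric multiplicities agree, i.e.
every generalised eigenvector is an eigenvector. -/
def IsSemisimpleEigenvalue (A : X →L[ℂ] X) (e : ℂ) : Prop :=
  Module.End.maxGenEigenspace A.toLinearMap e = Module.End.eigenspace A.toLinearMap e

theorem eq_zero_of_apply_eq_add_fixed {A : X →L[ℂ] X} (hA : ‖A‖ ≤ 1) {x y : X} (hx : A x = x)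
    (hy : A y = y + x) : x = 0 := by
  have hbdd : ∀ n : ℕ, ‖y + n • x‖ ≤ ‖y‖ := by
    intro n
    induction n with
    | zero => simp
    | succ n ih =>
      calc ‖y + (n + 1) • x‖ = ‖A (y + n • x)‖ := by
            rw [map_add, map_nsmul, hx, hy, succ_nsmul']; abel_nf
        _ ≤ ‖y + n • x‖ := A.le_of_opNorm_le_of_le hA le_rfl |>.trans_eq (one_mul _)
        _ ≤ ‖y‖ := ih
  have hlin : ∀ n : ℕ, n * ‖x‖ ≤ 2 * ‖y‖ := fun n =>
    calc n * ‖x‖ = ‖(y + n • x) - y‖ := by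
            rw [add_sub_cancel_left, RCLike.norm_nsmul ℂ, nsmul_eq_mul]
      _ ≤ ‖y + n • x‖ + ‖y‖ := norm_sub_le _ _
      _ ≤ 2 * ‖y‖ := by linarith [hbdd n]
  by_contra hne
  obtain ⟨n, hn⟩ := exists_nat_gt (2 * ‖y‖ / ‖x‖)
  exact (hlin n).not_gt ((div_lt_iff₀ (norm_pos_iff.2 hne)).1 hn)

theorem isSemisimpleEigenvalue_of_norm_le_one {A : X →L[ℂ] X} (hA : ‖A‖ ≤ 1) {e : ℂ}
    (he : ‖e‖ = 1) : IsSemisimpleEigenvalue A e := by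
  have he0 : e ≠ 0 := norm_ne_zero_iff.1 (he ▸ one_ne_zero)
  have hJordan : ∀ {x y : X}, A x = e • x → A y - e • y = x → x = 0 := fun {x y} hx hy => by
    have := eq_zero_of_apply_eq_add_fixed (A := e⁻¹ • A) (x := e⁻¹ • x) (y := y)
      (by rw [norm_smul, norm_inv, he, inv_one, one_mul]; exact hA)
      (by simp [hx, smul_smul, he0]) (by simp [← hy, smul_sub, smul_smul, he0])
    exact (smul_eq_zero_iff_right (inv_ne_zero he0)).1 this
  refine le_antisymm (fun x hx => ?_) Module.End.eigenspace_le_maxGenEigenspace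
  obtain ⟨k, hk⟩ := (Module.End.mem_maxGenEigenspace _ _ _).1 hx
  induction k generalizing x with
  | zero => simp_all
  | succ k ih =>
    have hAx : A x - e • x ∈ Module.End.eigenspace A.toLinearMap e := by
      refine ih _ ((Module.End.mem_maxGenEigenspace _ _ _).2 ⟨k, ?_⟩) ?_ <;>
      simpa [pow_succ] using hk
    exact Module.End.mem_eigenspace_iff.2
      (sub_eq_zero.1 (hJordan (Module.End.mem_eigenspace_iff.1 hAx) rfl))

theorem IsSimpleEigenvalue.isSemisimpleEigenvalue [FiniteDimensional ℂ X] {A : X →L[ℂ] X} {e : ℂ}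
    (h : IsSimpleEigenvalue A e) : IsSemisimpleEigenvalue A e := by
  refine (Submodule.eq_of_le_of_finrank_le Module.End.eigenspace_le_maxGenEigenspace
    (h.trans_le ?_)).symm
  have hne : Module.End.maxGenEigenspace A.toLinearMap e ≠ ⊥ := fun h0 => by
    rw [IsSimpleEigenvalue, h0, finrank_bot] at h
    exact zero_ne_one h
  exact Submodule.one_le_finrank_iff.2
    ((Module.End.hasUnifEigenvalue_iff_hasUnifEigenvalue_one (by simp)).1 hne)

end SemisimpleEigenvalue

section Eigenprojection

variable {X : Type*} [NormedAddCommGroup X] [NormedSpace ℂ X]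

/-- `P` is the spectral projection of `A` at a semisimple eigenvalue `e`: it commutes with `A` and
projects onto the eigenspace of `e`. -/
structure IsEigenprojection (A : X →L[ℂ] X) (e : ℂ) (P : X →L[ℂ] X) : Prop where
  mul_left : A * P = e • P
  mul_right : P * A = e • P
  apply_eq : ∀ x, A x = e • x → P x = x

namespace IsEigenprojection

variable {A P : X →L[ℂ] X} {e : ℂ}

theorem commute (h : IsEigenprojection A e P) : Commute A P :=
  h.mul_left.trans h.mul_right.symm

theorem apply_apply (h : IsEigenprojection A e P) (x : X) : A (P x) = e • P x :=
  congr($h.mul_left x)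

theorem apply_apply' (h : IsEigenprojection A e P) (x : X) : P (A x) = e • P x :=
  congr($h.mul_right x)

theorem isIdempotentElem (h : IsEigenprojection A e P) : IsIdempotentElem P := by
  ext x
  exact h.apply_eq _ (h.apply_apply x)

theorem mul_eq_zero {e' : ℂ} {P' : X →L[ℂ] X} (h : IsEigenprojection A e P)
    (h' : IsEigenprojection A e' P') (hne : e ≠ e') : P * P' = 0 := by
  have : e • (P * P') = e' • (P * P') := by
    rw [← smul_mul_assoc, ← h.mul_right, mul_assoc, h'.mul_left, mul_smul_comm]
  rw [← sub_eq_zero, ← sub_smul, smul_eq_zero] at this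
  exact this.resolve_left (sub_ne_zero.2 hne)

theorem apply_eq_zero {μ : ℂ} {x : X} (h : IsEigenprojection A e P) (hx : A x = μ • x)
    (hne : μ ≠ e) : P x = 0 := by
  have : μ • P x = e • P x := by rw [← map_smul, ← hx, h.apply_apply']
  rw [← sub_eq_zero, ← sub_smul, smul_eq_zero] at this
  exact this.resolve_left (sub_ne_zero.2 hne)

theorem isSimpleEigenvalue_iff (h : IsEigenprojection A e P) (hA : IsSemisimpleEigenvalue A e) :
    IsSimpleEigenvalue A e ↔ Module.finrank ℂ (LinearMap.range P.toLinearMap) = 1 := by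
  have : Module.End.eigenspace A.toLinearMap e = LinearMap.range P.toLinearMap := by
    ext x
    refine Module.End.mem_eigenspace_iff.trans ⟨fun hx => ⟨x, h.apply_eq x hx⟩, ?_⟩
    rintro ⟨y, rfl⟩
    exact h.apply_apply y
  rw [IsSimpleEigenvalue, hA, this]

variable [FiniteDimensional ℂ X]

theorem isUnit (h : IsEigenprojection A e P) : IsUnit (A - e • 1 + P) := by
  refine isUnit_of_forall_apply_eq_zero fun x hx => ?_
  have hsum : A x - e • x + P x = 0 := by simpa using hx
  have hPx : P x = 0 := by
    have hPP : P (P x) = P x := congr($h.isIdempotentElem x)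
    simpa [h.apply_apply', hPP] using congr(P $hsum)
  rw [hPx, add_zero, sub_eq_zero] at hsum
  rw [← h.apply_eq x hsum, hPx]

theorem resolvent_eq (h : IsEigenprojection A e P) {z : ℂ} (hz : z ≠ e)
    (hres : z ∈ resolventSet ℂ (A + P)) :
    resolvent A z = (z - e)⁻¹ • P + resolvent (A + P) z * (1 - P) := by
  refine ringInverse_eq_of_mul_eq_one ?_
  have hP : (z - e)⁻¹ • P * (algebraMap ℂ _ z - A) = P := by
    rw [smul_mul_assoc, mul_sub, h.mul_right, Algebra.algebraMap_eq_smul_one, mul_smul_comm,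
      mul_one, ← sub_smul, inv_smul_smul₀ (sub_ne_zero.2 hz)]
  have hcompl : (1 - P) * (algebraMap ℂ _ z - A) = (algebraMap ℂ _ z - (A + P)) * (1 - P) := by
    simp only [mul_sub, sub_mul, add_mul, mul_one, one_mul, h.isIdempotentElem.eq, h.commute.eq,
      Algebra.commutes z P]
    abel
  rw [add_mul, hP, mul_assoc, hcompl, resolvent, Ring.inverse_mul_cancel_left _ _ hres]
  abel

end IsEigenprojection

variable [FiniteDimensional ℂ X]

theorem spectralProjector_eq_of_resolvent_eq {A : X →L[ℂ] X} {e : ℂ} {F : ℂ → X →L[ℂ] X}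
    (hF : ∀ᶠ z in 𝓝 e, DifferentiableAt ℂ F z)
    (hres : ∀ᶠ z in 𝓝 e, z ≠ e → resolvent A z = (z - e)⁻¹ • F z) :
    spectralProjector A e = F e := by
  have := FiniteDimensional.complete ℂ X
  obtain ⟨δ, hδ, hball⟩ := Metric.eventually_nhds_iff_ball.1 (hF.and hres)
  refine (tendsto_const_nhds.congr' ?_).limUnder_eq
  filter_upwards [Ioo_mem_nhdsGT hδ] with r ⟨hr, hrδ⟩
  have hsub : Metric.closedBall e r ⊆ Metric.ball e δ := Metric.closedBall_subset_ball hrδ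
  have hcongr : ∮ z in C(e, r), resolvent A z = ∮ z in C(e, r), (z - e)⁻¹ • F z :=
    circleIntegral.integral_congr hr.le fun z hz =>
      (hball z (hsub (Metric.sphere_subset_closedBall hz))).2 (Metric.ne_of_mem_sphere hz hr.ne')
  have hdiff : DifferentiableOn ℂ F (Metric.closedBall e r) := fun z hz =>
    (hball z (hsub hz)).1.differentiableWithinAt
  rw [hcongr, hdiff.circleIntegral_sub_inv_smul (Metric.mem_ball_self hr),
    inv_smul_smul₀ Complex.two_pi_I_ne_zero]

theorem IsEigenprojection.spectralProjector_eq {A P : X →L[ℂ] X} {e : ℂ}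
    (h : IsEigenprojection A e P) : spectralProjector A e = P := by
  have := FiniteDimensional.complete ℂ X
  have hmem : e ∈ resolventSet ℂ (A + P) := by
    have : algebraMap ℂ (X →L[ℂ] X) e - (A + P) = -(A - e • 1 + P) := by
      rw [Algebra.algebraMap_eq_smul_one]; abel
    rw [spectrum.mem_resolventSet_iff, this]
    exact h.isUnit.neg
  have hnhds : ∀ᶠ z in 𝓝 e, z ∈ resolventSet ℂ (A + P) :=
    (spectrum.isOpen_resolventSet _).mem_nhds hmem
  have hF := spectralProjector_eq_of_resolvent_eq (A := A) (e := e)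
    (F := fun z => P + (z - e) • (resolvent (A + P) z * (1 - P))) ?_ ?_
  · simpa using hF
  · filter_upwards [hnhds] with z hz
    have := (spectrum.hasDerivAt_resolvent_const_left hz).differentiableAt
    fun_prop
  · filter_upwards [hnhds] with z hz hne
    rw [h.resolvent_eq hne hz, smul_add, inv_smul_smul₀ (sub_ne_zero.2 hne)]

theorem IsSemisimpleEigenvalue.exists_isEigenprojection {A : X →L[ℂ] X} {e : ℂ}
    (h : IsSemisimpleEigenvalue A e) : ∃ P, IsEigenprojection A e P := by
  set T : X →ₗ[ℂ] X := A.toLinearMap - e • 1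
  have hTapply : ∀ x, T x = A x - e • x := fun x => rfl
  have hdisj : Disjoint (LinearMap.ker T) (LinearMap.range T) := by
    rw [Submodule.disjoint_def]
    rintro _ hx ⟨y, rfl⟩
    have hy : y ∈ Module.End.eigenspace A.toLinearMap e :=
      h ▸ (Module.End.mem_maxGenEigenspace _ _ _).2 ⟨2, by rw [pow_two]; exact hx⟩
    exact sub_eq_zero.2 (Module.End.mem_eigenspace_iff.1 hy)
  have hcompl : IsCompl (LinearMap.ker T) (LinearMap.range T) :=
    (Submodule.isCompl_iff_disjoint _ _
      (by rw [add_comm]; exact (LinearMap.finrank_range_add_finrank_ker T).ge)).2 hdisj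
  refine ⟨((LinearMap.ker T).projection _ hcompl).toContinuousLinearMap, ?_, ?_, fun x hx => ?_⟩
  · ext x
    have := Submodule.projection_apply_mem hcompl x
    exact sub_eq_zero.1 this
  · ext x
    have : (LinearMap.ker T).projection _ hcompl (T x) = 0 :=
      (Submodule.projection_apply_eq_zero_iff hcompl).2 ⟨x, rfl⟩
    rw [hTapply, map_sub, map_smul] at this
    exact sub_eq_zero.1 this
  · exact Submodule.projection_apply_of_mem_left hcompl (sub_eq_zero.2 hx)

theorem IsSimpleEigenvalue.exists_isEigenprojection_smulRight {A : X →L[ℂ] X} {e : ℂ}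
    (h : IsSimpleEigenvalue A e) :
    ∃ (f : X →L[ℂ] ℂ) (η : X), f η = 1 ∧ IsEigenprojection A e (f.smulRight η) := by
  obtain ⟨P, hP⟩ := h.isSemisimpleEigenvalue.exists_isEigenprojection
  obtain ⟨⟨η, hηP⟩, hη0, hspan⟩ := finrank_eq_one_iff'.1
    ((hP.isSimpleEigenvalue_iff h.isSemisimpleEigenvalue).1 h)
  obtain ⟨g, hg⟩ := SeparatingDual.exists_eq_one (R := ℂ) (fun h0 => hη0 (Subtype.ext h0) : η ≠ 0)
  have hPη : P η = η := by
    obtain ⟨y, rfl⟩ := hηP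
    exact congr($hP.isIdempotentElem y)
  have hrank : (g ∘L P).smulRight η = P := by
    ext x
    obtain ⟨c, hc⟩ := hspan ⟨P x, x, rfl⟩
    have hPx : P x = c • η := congr(Subtype.val $hc).symm
    simp [hPx, hg]
  exact ⟨g ∘L P, η, by simp [hPη, hg], by rwa [hrank]⟩

theorem isSimpleEigenvalue_of_left_eigenspace_le_span {A : X →L[ℂ] X} {e : ℂ}
    (hA : IsSemisimpleEigenvalue A e) (he : e ∈ spectrum ℂ A) (f : X →L[ℂ] ℂ)
    (hf : ∀ g : X →L[ℂ] ℂ, (∀ x, g (A x) = e * g x) → ∃ c : ℂ, g = c • f) :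
    IsSimpleEigenvalue A e := by
  obtain ⟨P, hP⟩ := hA.exists_isEigenprojection
  rw [hP.isSimpleEigenvalue_iff hA]
  refine le_antisymm ?_ (Submodule.one_le_finrank_iff.2 fun h0 => ?_)
  · have hdual : LinearMap.range P.toLinearMap.dualMap ≤ Submodule.span ℂ {f.toLinearMap} := by
      rintro _ ⟨g, rfl⟩
      obtain ⟨c, hc⟩ := hf (g.toContinuousLinearMap ∘L P) fun x => by simp [hP.apply_apply']
      exact Submodule.mem_span_singleton.2 ⟨c, congr(($hc).toLinearMap).symm⟩
    rw [← LinearMap.finrank_range_dualMap_eq_finrank_range]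
    exact (Submodule.finrank_mono hdual).trans ((finrank_span_le_card _).trans_eq (by simp))
  · obtain ⟨x, hx0, hx⟩ := mem_spectrum_iff_exists_eigenvector.1 he
    have hPx : P x = x := hP.apply_eq x hx
    exact hx0 ((Submodule.mem_bot ℂ).1 (h0 ▸ ⟨x, hPx⟩))

theorem IsEigenprojection.spectrum_mul_one_sub_subset {A P : X →L[ℂ] X} {e : ℂ}
    (h : IsEigenprojection A e P) :
    spectrum ℂ (A * (1 - P)) ⊆ insert 0 (spectrum ℂ A \ {e}) := by
  intro μ hμ
  refine or_iff_not_imp_left.2 fun hμ0 => ?_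
  obtain ⟨v, hv0, hv⟩ := mem_spectrum_iff_exists_eigenvector.1 hμ
  have hPv : P v = 0 := by
    have hPB : P * (A * (1 - P)) = 0 := by
      rw [← mul_assoc, h.mul_right, smul_mul_assoc, h.isIdempotentElem.mul_one_sub_self, smul_zero]
    have := congr($hPB v)
    rw [mul_apply_eq_comp, hv, map_smul] at this
    exact (smul_eq_zero_iff_right hμ0).1 this
  have hAv : A v = μ • v := by simpa [hPv] using hv
  refine ⟨mem_spectrum_iff_exists_eigenvector.2 ⟨v, hv0, hAv⟩, ?_⟩
  rintro rfl
  exact hv0 (by rw [← h.apply_eq v hAv, hPv])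

theorem IsEigenprojection.pow {A P : X →L[ℂ] X} {e : ℂ} (h : IsEigenprojection A e P) {m : ℕ}
    (hm : m ≠ 0) (he : e ≠ 0) (hsp : ∀ z ∈ spectrum ℂ A, z ^ m = e ^ m → z = e) :
    IsEigenprojection (A ^ m) (e ^ m) P := by
  have hpow : A ^ m * P = e ^ m • P := by
    clear hm hsp
    induction m with
    | zero => simp
    | succ m ih => rw [pow_succ, mul_assoc, h.mul_left, mul_smul_comm, ih, smul_smul, pow_succ']
  refine ⟨hpow, (h.commute.pow_left m).eq.symm.trans hpow, fun x hx => ?_⟩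
  by_contra hne
  have hy : ((A * (1 - P)) ^ m) (x - P x) = e ^ m • (x - P x) := by
    have hQ : (1 - P) (x - P x) = x - P x := by
      have hPP : P (P x) = P x := congr($h.isIdempotentElem x)
      simp [hPP]
    rw [((Commute.one_right A).sub_right h.commute).mul_pow, h.isIdempotentElem.one_sub.pow_eq hm,
      mul_apply_eq_comp, hQ, map_sub, hx, smul_sub]
    exact congr(_ - $hpow x)
  have hmem : e ^ m ∈ spectrum ℂ ((A * (1 - P)) ^ m) :=
    mem_spectrum_iff_exists_eigenvector.2 ⟨_, sub_ne_zero.2 (Ne.symm hne), hy⟩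
  rw [spectrum.map_pow_of_pos _ (Nat.pos_of_ne_zero hm)] at hmem
  obtain ⟨μ, hμ, hμm : μ ^ m = e ^ m⟩ := hmem
  rcases h.spectrum_mul_one_sub_subset hμ with rfl | ⟨hμA, hμe⟩
  · exact pow_ne_zero m he (by rw [← hμm, zero_pow hm])
  · exact hμe (hsp μ hμA hμm)

end Eigenprojection

section Peripheral

variable {X : Type*} [NormedAddCommGroup X] [NormedSpace ℂ X]

theorem norm_eq_one_of_mem_peripheralSpectrum {A : X →L[ℂ] X} {e : ℂ}
    (he : e ∈ peripheralSpectrum A) : ‖e‖ = 1 :=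
  mem_sphere_zero_iff_norm.1 he.2

theorem norm_pow_le_one {A : X →L[ℂ] X} {m : ℕ} (hA : ‖A‖ ≤ 1) (hm : m ≠ 0) : ‖A ^ m‖ ≤ 1 :=
  (norm_pow_le' A (Nat.pos_of_ne_zero hm)).trans (pow_le_one₀ (norm_nonneg _) hA)

theorem peripheralSpectrum_pow {A : X →L[ℂ] X} {m : ℕ} (hm : m ≠ 0)
    (hper : ∀ e ∈ peripheralSpectrum A, e ^ m = e) :
    peripheralSpectrum (A ^ m) = peripheralSpectrum A := by
  ext e
  rw [peripheralSpectrum, spectrum.map_pow_of_pos _ (Nat.pos_of_ne_zero hm)]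
  constructor
  · rintro ⟨⟨z, hz, rfl⟩, hz1⟩
    have hz' : z ∈ peripheralSpectrum A := by
      refine ⟨hz, mem_sphere_zero_iff_norm.2 ?_⟩
      simpa [pow_eq_one_iff_of_nonneg, hm] using hz1
    simpa only [hper z hz'] using hz'
  · exact fun he => ⟨⟨e, he.1, hper e he⟩, he.2⟩

variable [FiniteDimensional ℂ X]

theorem finite_peripheralSpectrum (A : X →L[ℂ] X) : (peripheralSpectrum A).Finite := by
  have := FiniteDimensional.complete ℂ X
  rw [peripheralSpectrum, ContinuousLinearMap.spectrum_eq]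
  exact (Module.End.finite_spectrum _).inter_of_left _

theorem peripheralProjector_eq_sum (A : X →L[ℂ] X) :
    peripheralProjector A = ∑ e ∈ (finite_peripheralSpectrum A).toFinset, spectralProjector A e :=
  finsum_mem_eq_finite_toFinset_sum _ _

theorem isEigenprojection_spectralProjector {A : X →L[ℂ] X} (hA : ‖A‖ ≤ 1) {e : ℂ}
    (he : ‖e‖ = 1) : IsEigenprojection A e (spectralProjector A e) := by
  obtain ⟨P, hP⟩ := (isSemisimpleEigenvalue_of_norm_le_one hA he).exists_isEigenprojection
  exact hP.spectralProjector_eq.symm ▸ hP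

theorem isEigenprojection_of_mem_peripheralSpectrum {A : X →L[ℂ] X} (hA : ‖A‖ ≤ 1) {e : ℂ}
    (he : e ∈ (finite_peripheralSpectrum A).toFinset) :
    IsEigenprojection A e (spectralProjector A e) :=
  isEigenprojection_spectralProjector hA
    (norm_eq_one_of_mem_peripheralSpectrum ((finite_peripheralSpectrum A).mem_toFinset.1 he))

theorem commute_peripheralProjector {A : X →L[ℂ] X} (hA : ‖A‖ ≤ 1) :
    Commute A (peripheralProjector A) := by
  rw [peripheralProjector_eq_sum]
  exact Commute.sum_right _ _ _ fun e he =>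
    (isEigenprojection_of_mem_peripheralSpectrum hA he).commute

theorem isIdempotentElem_peripheralProjector {A : X →L[ℂ] X} (hA : ‖A‖ ≤ 1) :
    IsIdempotentElem (peripheralProjector A) := by
  rw [IsIdempotentElem, peripheralProjector_eq_sum, Finset.sum_mul]
  refine Finset.sum_congr rfl fun e he => ?_
  have hP := isEigenprojection_of_mem_peripheralSpectrum hA he
  rw [Finset.mul_sum, Finset.sum_eq_single_of_mem e he fun e' he' hne =>
    hP.mul_eq_zero (isEigenprojection_of_mem_peripheralSpectrum hA he') hne.symm]
  exact hP.isIdempotentElem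

theorem nonperipheralPart_pow {A : X →L[ℂ] X} (hA : ‖A‖ ≤ 1) {n : ℕ} (hn : n ≠ 0) :
    nonperipheralPart A ^ n = A ^ n * (1 - peripheralProjector A) := by
  rw [nonperipheralPart, ((Commute.one_right A).sub_right (commute_peripheralProjector hA)).mul_pow,
    (isIdempotentElem_peripheralProjector hA).one_sub.pow_eq hn]

theorem mem_spectrum_nonperipheralPart {A : X →L[ℂ] X} (hA : ‖A‖ ≤ 1) {μ : ℂ}
    (hμ : μ ∈ spectrum ℂ A) (hμ1 : ‖μ‖ ≠ 1) : μ ∈ spectrum ℂ (nonperipheralPart A) := by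
  obtain ⟨x, hx0, hx⟩ := mem_spectrum_iff_exists_eigenvector.1 hμ
  have hP : peripheralProjector A x = 0 := by
    rw [peripheralProjector_eq_sum, sum_apply]
    refine Finset.sum_eq_zero fun e he => ?_
    refine (isEigenprojection_of_mem_peripheralSpectrum hA he).apply_eq_zero hx ?_
    rintro rfl
    exact hμ1 (norm_eq_one_of_mem_peripheralSpectrum (by simpa using he))
  exact mem_spectrum_iff_exists_eigenvector.2 ⟨x, hx0, by simp [nonperipheralPart, hP, hx]⟩

section Powers

variable {A : X →L[ℂ] X} {m : ℕ}

theorem spectralProjector_pow (hA : ‖A‖ ≤ 1) (hm : m ≠ 0)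
    (hper : ∀ e ∈ peripheralSpectrum A, e ^ m = e) {e : ℂ} (he : e ∈ peripheralSpectrum A) :
    spectralProjector (A ^ m) e = spectralProjector A e := by
  have he1 := norm_eq_one_of_mem_peripheralSpectrum he
  have hpow := (isEigenprojection_spectralProjector hA he1).pow hm
    (norm_ne_zero_iff.1 (he1 ▸ one_ne_zero)) fun z hz hze => ?_
  · rw [hper e he] at hpow
    exact hpow.spectralProjector_eq
  · have hz1 : ‖z‖ = 1 := by
      rw [← pow_eq_one_iff_of_nonneg (norm_nonneg z) hm, ← norm_pow, hze, norm_pow, he1, one_pow]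
    rw [← hper e he, ← hze, hper z ⟨hz, mem_sphere_zero_iff_norm.2 hz1⟩]

theorem peripheralProjector_pow (hA : ‖A‖ ≤ 1) (hm : m ≠ 0)
    (hper : ∀ e ∈ peripheralSpectrum A, e ^ m = e) :
    peripheralProjector (A ^ m) = peripheralProjector A := by
  rw [peripheralProjector, peripheralProjector, peripheralSpectrum_pow hm hper]
  exact finsum_mem_congr rfl fun e he => spectralProjector_pow hA hm hper he

theorem nonperipheralPart_of_pow (hA : ‖A‖ ≤ 1) (hm : m ≠ 0)
    (hper : ∀ e ∈ peripheralSpectrum A, e ^ m = e) :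
    nonperipheralPart (A ^ m) = nonperipheralPart A ^ m := by
  rw [nonperipheralPart, peripheralProjector_pow hA hm hper, nonperipheralPart_pow hA hm]

theorem IsSimpleEigenvalue.pow (hA : ‖A‖ ≤ 1) (hm : m ≠ 0)
    (hper : ∀ e ∈ peripheralSpectrum A, e ^ m = e) {e : ℂ} (he : e ∈ peripheralSpectrum A)
    (h : IsSimpleEigenvalue A e) : IsSimpleEigenvalue (A ^ m) e := by
  have he1 := norm_eq_one_of_mem_peripheralSpectrum he
  have hAm := norm_pow_le_one hA hm
  rw [(isEigenprojection_spectralProjector hAm he1).isSimpleEigenvalue_iff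
    (isSemisimpleEigenvalue_of_norm_le_one hAm he1), spectralProjector_pow hA hm hper he]
  exact ((isEigenprojection_spectralProjector hA he1).isSimpleEigenvalue_iff
    (isSemisimpleEigenvalue_of_norm_le_one hA he1)).1 h

end Powers

end Peripheral

section Smoothness

variable {X : Type*} [NormedAddCommGroup X] [NormedSpace ℂ X]

theorem IsEigenprojection.smulRight_eq_of_isUnit {A : X →L[ℂ] X} {e : ℂ} {f f₀ : X →L[ℂ] ℂ}
    {η η₀ : X} (h : IsEigenprojection A e (f.smulRight η)) (hfη : f η = 1)
    (hu : IsUnit (A - e • 1 + f₀.smulRight η₀)) {R : X →L[ℂ] X}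
    (hR : R = Ring.inverse (A - e • 1 + f₀.smulRight η₀)) :
    f₀ ((R * R) η₀) ≠ 0 ∧
      f.smulRight η = (f₀ ((R * R) η₀))⁻¹ • (R * f₀.smulRight η₀ * R) := by
  have hη : η = f₀ η • R η₀ := by
    have hAη : A η = e • η := by simpa [hfη] using h.apply_apply η
    have hRT := congr($(Ring.inverse_mul_cancel _ hu) η)
    rw [← hR] at hRT
    simpa [hAη] using hRT.symm
  have hf : ∀ x, f x = f₀ (R x) * f η₀ := fun x => by
    have hfA : ∀ y, f (A y) = e * f y := fun y => by
      simpa [hfη] using congr(f $(h.apply_apply' y))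
    have hTR := congr(f ($(Ring.mul_inverse_cancel _ hu) x))
    rw [← hR] at hTR
    simpa [hfA] using hTR.symm
  have hone : f₀ ((R * R) η₀) * (f₀ η * f η₀) = 1 := by
    rw [← hfη, hf η]
    conv_rhs => rw [hη]
    simp only [map_smul, smul_eq_mul, mul_apply_eq_comp]
    ring
  refine ⟨left_ne_zero_of_mul_eq_one hone, ?_⟩
  rw [inv_eq_of_mul_eq_one_right hone]
  ext x
  calc f x • η = (f₀ (R x) * f η₀) • f₀ η • R η₀ := by rw [← hη, ← hf]
    _ = (f₀ η * f η₀) • f₀ (R x) • R η₀ := by rw [smul_smul, smul_smul]; ring_nf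
    _ = _ := by simp

variable [FiniteDimensional ℂ X]

theorem contDiffOn_spectralProjector {L : ℝ → X →L[ℂ] X} {t : Set ℝ} {n : ℕ∞}
    (hL : ContDiffOn ℝ n L t) {e : ℂ} (h : ∀ s ∈ t, IsSimpleEigenvalue (L s) e) :
    ContDiffOn ℝ n (fun s => spectralProjector (L s) e) t := by
  have := FiniteDimensional.complete ℂ X
  intro s₀ hs₀
  obtain ⟨f₀, η₀, -, h₀⟩ := (h s₀ hs₀).exists_isEigenprojection_smulRight
  let T : ℝ → X →L[ℂ] X := fun s => L s - e • 1 + f₀.smulRight η₀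
  let R : ℝ → X →L[ℂ] X := fun s => Ring.inverse (T s)
  let φ : (X →L[ℂ] X) →L[ℝ] ℂ := (f₀ ∘L ContinuousLinearMap.apply ℂ X η₀).restrictScalars ℝ
  have hT : ContDiffWithinAt ℝ n T t s₀ :=
    ((hL s₀ hs₀).sub contDiffWithinAt_const).add contDiffWithinAt_const
  have hu : IsUnit (T s₀) := h₀.isUnit
  have hinverse : ContDiffAt ℝ n Ring.inverse (T s₀) := contDiffAt_ringInverse ℝ hu.unit
  have hR : ContDiffWithinAt ℝ n R t s₀ := hinverse.comp_contDiffWithinAt s₀ hT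
  have hφ : ContDiffWithinAt ℝ n (fun s => φ (R s * R s)) t s₀ :=
    φ.contDiff.comp_contDiffWithinAt (hR.mul hR)
  have hformula : ∀ s ∈ t, IsUnit (T s) → φ (R s * R s) ≠ 0 ∧
      spectralProjector (L s) e = (φ (R s * R s))⁻¹ • (R s * f₀.smulRight η₀ * R s) := by
    intro s hs hus
    obtain ⟨f, η, hfη, hP⟩ := (h s hs).exists_isEigenprojection_smulRight
    rw [hP.spectralProjector_eq]
    exact hP.smulRight_eq_of_isUnit hfη hus rfl
  have hG : ContDiffWithinAt ℝ n
      (fun s => (φ (R s * R s))⁻¹ • (R s * f₀.smulRight η₀ * R s)) t s₀ :=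
    (hφ.inv (hformula s₀ hs₀ hu).1).smul ((hR.mul contDiffWithinAt_const).mul hR)
  have hunits : ∀ᶠ s in 𝓝[t] s₀, IsUnit (T s) :=
    hT.continuousWithinAt.eventually (Units.isOpen.mem_nhds hu)
  refine hG.congr_of_eventuallyEq ?_ (hformula s₀ hs₀ hu).2
  filter_upwards [hunits, self_mem_nhdsWithin] with s hus hs
  exact (hformula s hs hus).2

theorem contDiffOn_peripheralProjector {L : ℝ → X →L[ℂ] X} {t : Set ℝ} {n : ℕ∞}
    (hL : ContDiffOn ℝ n L t) {S : Set ℂ} (hS : ∀ s ∈ t, peripheralSpectrum (L s) = S)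
    (h : ∀ s ∈ t, ∀ e ∈ S, IsSimpleEigenvalue (L s) e) :
    ContDiffOn ℝ n (fun s => peripheralProjector (L s)) t := by
  rcases t.eq_empty_or_nonempty with rfl | ⟨s₀, hs₀⟩
  · exact contDiffOn_empty
  have hfin : S.Finite := hS s₀ hs₀ ▸ finite_peripheralSpectrum (L s₀)
  have hsum : ContDiffOn ℝ n (fun s => ∑ e ∈ hfin.toFinset, spectralProjector (L s) e) t :=
    ContDiffOn.sum fun e he =>
      contDiffOn_spectralProjector hL fun s hs => h s hs e (hfin.mem_toFinset.1 he)
  refine hsum.congr fun s hs => ?_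
  rw [peripheralProjector, hS s hs, finsum_mem_eq_finite_toFinset_sum _ hfin]

end Smoothness
section SpectralGap

theorem exists_pos_forall_lt_norm_sub {E : Type*} [NormedAddCommGroup E] {S : Set E}
    (hS : S.Finite) : ∃ ε : ℝ, 0 < ε ∧ ∀ x ∈ S, ∀ y ∈ S, x ≠ y → ε < ‖x - y‖ := by
  have hsep : ∀ᶠ ε in 𝓝[>] (0 : ℝ), ∀ p ∈ S.offDiag, ε < ‖p.1 - p.2‖ :=
    hS.offDiag.eventually_all.2 fun p hp =>
      nhdsWithin_le_nhds (Iio_mem_nhds (norm_pos_iff.2 (sub_ne_zero.2 hp.2.2)))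
  obtain ⟨ε, hε, hpos⟩ := (hsep.and self_mem_nhdsWithin).exists
  exact ⟨ε, hpos, fun x hx y hy hne => hε (x, y) ⟨hx, hy, hne⟩⟩

theorem pow_card_le_norm_multiset_prod {m : Multiset ℂ} {δ : ℝ} (hδ : 0 ≤ δ)
    (h : ∀ μ ∈ m, δ ≤ ‖μ‖) : δ ^ m.card ≤ ‖m.prod‖ := by
  induction m using Multiset.induction_on with
  | empty => simp
  | cons a m ih =>
    rw [Multiset.card_cons, Multiset.prod_cons, pow_succ', norm_mul]
    exact mul_le_mul (h a (Multiset.mem_cons_self a m))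
      (ih fun b hb => h b (Multiset.mem_cons_of_mem hb)) (pow_nonneg hδ _) (norm_nonneg _)

theorem eq_zero_of_isPreconnected_of_gap {α : Type*} [TopologicalSpace α] {t : Set α}
    (ht : IsPreconnected t) {f : α → ℝ} (hf : ContinuousOn f t) {η : ℝ} (hη : 0 < η)
    (hgap : ∀ s ∈ t, f s = 0 ∨ η ≤ f s) {s : α} (hs : s ∈ t) (hs0 : f s = 0) :
    ∀ s' ∈ t, f s' = 0 := by
  intro s' hs'
  refine (hgap s' hs').resolve_right fun hle => ?_
  obtain ⟨r, hr, hfr⟩ := ht.intermediate_value hs hs' hf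
    (show η / 2 ∈ Icc (f s) (f s') by rw [hs0]; constructor <;> linarith)
  rcases hgap r hr with h | h <;> linarith

variable {X : Type*} [NormedAddCommGroup X] [NormedSpace ℂ X] [FiniteDimensional ℂ X]

theorem det_smul_one_sub (A : X →L[ℂ] X) (e : ℂ) :
    (e • (1 : X →L[ℂ] X) - A).det = A.toLinearMap.charpoly.eval e := by
  rw [LinearMap.eval_charpoly, Algebra.algebraMap_eq_smul_one]
  rfl

theorem mem_spectrum_iff_isRoot_charpoly {A : X →L[ℂ] X} {e : ℂ} :
    e ∈ spectrum ℂ A ↔ A.toLinearMap.charpoly.IsRoot e := by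
  have := FiniteDimensional.complete ℂ X
  rw [ContinuousLinearMap.spectrum_eq, ← Module.End.hasEigenvalue_iff_mem_spectrum,
    Module.End.hasEigenvalue_iff_isRoot_charpoly]

theorem mem_spectrum_iff_det_eq_zero {A : X →L[ℂ] X} {e : ℂ} :
    e ∈ spectrum ℂ A ↔ (e • (1 : X →L[ℂ] X) - A).det = 0 := by
  rw [det_smul_one_sub, mem_spectrum_iff_isRoot_charpoly, Polynomial.IsRoot]

theorem pow_finrank_le_norm_det_smul_one_sub {A : X →L[ℂ] X} {e : ℂ} {δ : ℝ} (hδ : 0 ≤ δ)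
    (h : ∀ μ ∈ spectrum ℂ A, δ ≤ ‖e - μ‖) :
    δ ^ Module.finrank ℂ X ≤ ‖(e • (1 : X →L[ℂ] X) - A).det‖ := by
  have hsplit := IsAlgClosed.splits A.toLinearMap.charpoly
  rw [det_smul_one_sub, hsplit.eval_eq_prod_roots, A.toLinearMap.charpoly_monic.leadingCoeff,
    one_mul, ← LinearMap.charpoly_natDegree A.toLinearMap, hsplit.natDegree_eq_card_roots,
    ← Multiset.card_map (fun μ => e - μ)]
  refine pow_card_le_norm_multiset_prod hδ fun ν hν => ?_
  obtain ⟨μ, hμ, rfl⟩ := Multiset.mem_map.1 hν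
  exact h μ (mem_spectrum_iff_isRoot_charpoly.2 (Polynomial.isRoot_of_mem_roots hμ))

theorem ncard_peripheralSpectrum_le (A : X →L[ℂ] X) :
    (peripheralSpectrum A).ncard ≤ Module.finrank ℂ X := by
  have hsub : peripheralSpectrum A ⊆ A.toLinearMap.charpoly.roots.toFinset := fun e he => by
    rw [Finset.mem_coe, Multiset.mem_toFinset,
      Polynomial.mem_roots A.toLinearMap.charpoly_monic.ne_zero]
    exact mem_spectrum_iff_isRoot_charpoly.1 he.1
  calc (peripheralSpectrum A).ncard
      ≤ A.toLinearMap.charpoly.roots.toFinset.card := by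
        rw [← Set.ncard_coe_finset]
        exact Set.ncard_le_ncard hsub
    _ ≤ A.toLinearMap.charpoly.roots.card := Multiset.toFinset_card_le _
    _ ≤ Module.finrank ℂ X :=
        (Polynomial.card_roots' _).trans_eq (LinearMap.charpoly_natDegree A.toLinearMap)

theorem peripheralSpectrum_subset_of_continuousOn {α : Type*} [TopologicalSpace α]
    {L : α → X →L[ℂ] X} {t : Set α} (ht : IsPreconnected t) (hL : ContinuousOn L t) {F : Set ℂ}
    (hF : F.Finite) (hLF : ∀ s ∈ t, peripheralSpectrum (L s) ⊆ F) {r : ℝ} (hr : r < 1)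
    (hLr : ∀ s ∈ t, ∀ μ ∈ spectrum ℂ (L s), ‖μ‖ ≠ 1 → ‖μ‖ ≤ r) {s s' : α} (hs : s ∈ t)
    (hs' : s' ∈ t) : peripheralSpectrum (L s) ⊆ peripheralSpectrum (L s') := by
  intro e he
  have he1 := norm_eq_one_of_mem_peripheralSpectrum he
  obtain ⟨ε, hε, hsep⟩ := exists_pos_forall_lt_norm_sub hF
  set δ : ℝ := min ε (1 - r)
  have hδ : 0 < δ := lt_min hε (sub_pos.2 hr)
  have hdist : ∀ u ∈ t, e ∉ spectrum ℂ (L u) → ∀ μ ∈ spectrum ℂ (L u), δ ≤ ‖e - μ‖ := by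
    intro u hu heu μ hμ
    by_cases hμ1 : ‖μ‖ = 1
    · exact (min_le_left _ _).trans (hsep e (hLF s hs he) μ
        (hLF u hu ⟨hμ, mem_sphere_zero_iff_norm.2 hμ1⟩) fun h => heu (h ▸ hμ)).le
    · calc δ ≤ ‖e‖ - ‖μ‖ := by linarith [min_le_right ε (1 - r), hLr u hu μ hμ hμ1]
        _ ≤ ‖e - μ‖ := norm_sub_norm_le e μ
  have hdet : ‖(e • (1 : X →L[ℂ] X) - L s').det‖ = 0 := by
    refine eq_zero_of_isPreconnected_of_gap ht (f := fun u => ‖(e • (1 : X →L[ℂ] X) - L u).det‖)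
      (ContinuousLinearMap.continuous_det.comp_continuousOn (continuousOn_const.sub hL)).norm
      (pow_pos hδ (Module.finrank ℂ X)) (fun u hu => ?_) hs ?_ s' hs'
    · refine or_iff_not_imp_left.2 fun h0 => pow_finrank_le_norm_det_smul_one_sub hδ.le ?_
      exact hdist u hu fun h => h0 (norm_eq_zero.2 (mem_spectrum_iff_det_eq_zero.1 h))
    · exact norm_eq_zero.2 (mem_spectrum_iff_det_eq_zero.1 he.1)
  exact ⟨mem_spectrum_iff_det_eq_zero.2 (norm_eq_zero.1 hdet), he.2⟩

end SpectralGap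

section Families

variable {X : Type*} [NormedAddCommGroup X] [NormedSpace ℂ X] {L : ℝ → X →L[ℂ] X}

theorem HasSpectralBound.spectralRadius_lt_one (h : HasSpectralBound L) {s : ℝ}
    (hs : s ∈ Icc (0 : ℝ) 1) : spectralRadius ℂ (nonperipheralPart (L s)) < 1 :=
  (le_iSup₂ (f := fun s (_ : s ∈ Icc (0 : ℝ) 1) =>
    spectralRadius ℂ (nonperipheralPart (L s))) s hs).trans_lt h

variable [FiniteDimensional ℂ X] {S : Set ℂ}

theorem nonperipheralSpectralRadius_le_nonperipheralNorm :
    nonperipheralSpectralRadius L ≤ nonperipheralNorm L := by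
  refine iSup₂_mono fun s _ => ?_
  cases subsingleton_or_nontrivial X
  · rw [spectrum.SpectralRadius.of_subsingleton]
    exact zero_le
  · exact spectrum.spectralRadius_le_nnnorm _

theorem HasNormBound.hasSpectralBound (h : HasNormBound L) : HasSpectralBound L :=
  nonperipheralSpectralRadius_le_nonperipheralNorm.trans_lt h

theorem enorm_le_nonperipheralSpectralRadius (hL : IsContractive L) {s : ℝ}
    (hs : s ∈ Icc (0 : ℝ) 1) {μ : ℂ} (hμ : μ ∈ spectrum ℂ (L s)) (hμ1 : ‖μ‖ ≠ 1) :
    ‖μ‖ₑ ≤ nonperipheralSpectralRadius L :=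
  calc ‖μ‖ₑ ≤ spectralRadius ℂ (nonperipheralPart (L s)) :=
        le_iSup₂ (f := fun k (_ : k ∈ spectrum ℂ (nonperipheralPart (L s))) => ‖k‖ₑ) μ
          (mem_spectrum_nonperipheralPart (hL s hs) hμ hμ1)
    _ ≤ nonperipheralSpectralRadius L :=
        le_iSup₂ (f := fun s (_ : s ∈ Icc (0 : ℝ) 1) =>
          spectralRadius ℂ (nonperipheralPart (L s))) s hs

theorem HasSpectralBound.peripheralSpectrum_eq (h : HasSpectralBound L) (hL : IsContractive L)
    (hcont : ContinuousOn L (Icc 0 1)) {F : Set ℂ} (hF : F.Finite)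
    (hLF : ∀ s ∈ Icc (0 : ℝ) 1, peripheralSpectrum (L s) ⊆ F) {s s' : ℝ} (hs : s ∈ Icc (0 : ℝ) 1)
    (hs' : s' ∈ Icc (0 : ℝ) 1) : peripheralSpectrum (L s) = peripheralSpectrum (L s') := by
  have hr : (nonperipheralSpectralRadius L).toReal < 1 :=
    (ENNReal.toReal_lt_toReal h.ne_top ENNReal.one_ne_top).2 h
  have hLr : ∀ s ∈ Icc (0 : ℝ) 1, ∀ μ ∈ spectrum ℂ (L s), ‖μ‖ ≠ 1 →
      ‖μ‖ ≤ (nonperipheralSpectralRadius L).toReal := fun s hs μ hμ hμ1 => by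
    rw [← toReal_enorm]
    exact ENNReal.toReal_mono h.ne_top (enorm_le_nonperipheralSpectralRadius hL hs hμ hμ1)
  exact (peripheralSpectrum_subset_of_continuousOn isPreconnected_Icc hcont hF hLF hr hLr hs
    hs').antisymm
    (peripheralSpectrum_subset_of_continuousOn isPreconnected_Icc hcont hF hLF hr hLr hs' hs)

theorem hasPeripheralGap_of_peripheralSpectrum_eq
    (hS : ∀ s ∈ Icc (0 : ℝ) 1, peripheralSpectrum (L s) = S)
    (h : ∀ s ∈ Icc (0 : ℝ) 1, ∀ e ∈ S, IsSimpleEigenvalue (L s) e) : HasPeripheralGap L := by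
  have hfin : S.Finite := hS 0 (by simp) ▸ finite_peripheralSpectrum (L 0)
  obtain ⟨ε, hε, hsep⟩ := exists_pos_forall_lt_norm_sub hfin
  refine ⟨ε / 2, half_pos hε, fun s hs => ?_⟩
  rw [hS s hs, mul_div_cancel₀ ε two_ne_zero]
  exact ⟨h s hs, hsep⟩

theorem isC2_peripheralProjector (hC2 : IsC2 L)
    (hS : ∀ s ∈ Icc (0 : ℝ) 1, peripheralSpectrum (L s) = S)
    (h : ∀ s ∈ Icc (0 : ℝ) 1, ∀ e ∈ S, IsSimpleEigenvalue (L s) e) :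
    IsC2 fun s => peripheralProjector (L s) :=
  contDiffOn_peripheralProjector (n := 2) hC2 hS h

theorem isAdiabatic_of_peripheralSpectrum_eq (hC2 : IsC2 L) (hL : IsContractive L)
    (hS : ∀ s ∈ Icc (0 : ℝ) 1, peripheralSpectrum (L s) = S)
    (h : ∀ s ∈ Icc (0 : ℝ) 1, ∀ e ∈ S, IsSimpleEigenvalue (L s) e) (hb : HasNormBound L) :
    IsAdiabatic L :=
  ⟨hL, hasPeripheralGap_of_peripheralSpectrum_eq hS h,
    ContDiffOn.mul hC2 (isC2_peripheralProjector hC2 hS h), hb⟩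

theorem tendsto_norm_pow_of_spectralRadius_lt_one {A : X →L[ℂ] X} (h : spectralRadius ℂ A < 1) :
    Tendsto (fun n : ℕ => ‖A ^ n‖) atTop (𝓝 0) := by
  have := FiniteDimensional.complete ℂ X
  obtain ⟨ρ, hρ, hρ1⟩ := ENNReal.lt_iff_exists_nnreal_btwn.1 h
  have hgelfand : ∀ᶠ n : ℕ in atTop, (‖A ^ n‖₊ : ENNReal) ^ (1 / n : ℝ) < ρ :=
    (spectrum.pow_nnnorm_pow_one_div_tendsto_nhds_spectralRadius A).eventually (gt_mem_nhds hρ)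
  refine squeeze_zero' (Eventually.of_forall fun n => norm_nonneg _) ?_
    (tendsto_pow_atTop_nhds_zero_of_lt_one ρ.2 (by exact_mod_cast hρ1))
  filter_upwards [hgelfand, eventually_gt_atTop 0] with n hn hn0
  have hle : (‖A ^ n‖₊ : ENNReal) ≤ (ρ : ENNReal) ^ n := by
    rw [← ENNReal.rpow_natCast, ← ENNReal.rpow_inv_le_iff (by exact_mod_cast hn0), ← one_div]
    exact hn.le
  exact_mod_cast hle

theorem antitone_norm_nonperipheralPart_pow_succ {A : X →L[ℂ] X} (hA : ‖A‖ ≤ 1) :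
    Antitone fun n : ℕ => ‖nonperipheralPart A ^ (n + 1)‖ := by
  refine antitone_nat_of_succ_le fun n => ?_
  calc ‖nonperipheralPart A ^ (n + 1 + 1)‖ = ‖A * nonperipheralPart A ^ (n + 1)‖ := by
        rw [nonperipheralPart_pow hA n.succ_ne_zero, nonperipheralPart_pow hA (n + 1).succ_ne_zero,
          pow_succ' A, mul_assoc]
    _ ≤ ‖A‖ * ‖nonperipheralPart A ^ (n + 1)‖ := norm_mul_le _ _
    _ ≤ ‖nonperipheralPart A ^ (n + 1)‖ := mul_le_of_le_one_left (norm_nonneg _) hA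

theorem tendstoUniformlyOn_norm_nonperipheralPart_pow {α : Type*} [TopologicalSpace α]
    {L : α → X →L[ℂ] X} {t : Set α} (ht : IsCompact t) (hL : ∀ s ∈ t, ‖L s‖ ≤ 1)
    (hcont : ContinuousOn (fun s => nonperipheralPart (L s)) t)
    (hρ : ∀ s ∈ t, spectralRadius ℂ (nonperipheralPart (L s)) < 1) :
    TendstoUniformlyOn (fun n s => ‖nonperipheralPart (L s) ^ (n + 1)‖) 0 atTop t :=
  Antitone.tendstoUniformlyOn_of_forall_tendsto ht (fun n => (hcont.pow (n + 1)).norm)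
    (fun s hs => antitone_norm_nonperipheralPart_pow_succ (hL s hs)) continuousOn_const
    fun s hs => (tendsto_norm_pow_of_spectralRadius_lt_one (hρ s hs)).comp (tendsto_add_atTop_nat 1)

theorem HasSpectralBound.eventually_norm_nonperipheralPart_pow_lt (hb : HasSpectralBound L)
    (hC2 : IsC2 L) (hL : IsContractive L) (hS : ∀ s ∈ Icc (0 : ℝ) 1, peripheralSpectrum (L s) = S)
    (h : ∀ s ∈ Icc (0 : ℝ) 1, ∀ e ∈ S, IsSimpleEigenvalue (L s) e) {ε : ℝ} (hε : 0 < ε) :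
    ∀ᶠ n : ℕ in atTop, ∀ s ∈ Icc (0 : ℝ) 1, ‖nonperipheralPart (L s) ^ (n + 1)‖ < ε := by
  have hcont : ContinuousOn (fun s => nonperipheralPart (L s)) (Icc 0 1) :=
    hC2.continuousOn.mul (continuousOn_const.sub (isC2_peripheralProjector hC2 hS h).continuousOn)
  have hunif := tendstoUniformlyOn_norm_nonperipheralPart_pow isCompact_Icc hL hcont fun s hs =>
    hb.spectralRadius_lt_one hs
  filter_upwards [Metric.tendstoUniformlyOn_iff.1 hunif ε hε] with n hn s hs
  simpa using hn s hs

theorem HasSpectralBound.exists_isAdiabatic_pow (hb : HasSpectralBound L) (hC2 : IsC2 L)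
    (hL : IsContractive L) (hS : ∀ s ∈ Icc (0 : ℝ) 1, peripheralSpectrum (L s) = S)
    (h : ∀ s ∈ Icc (0 : ℝ) 1, ∀ e ∈ S, IsSimpleEigenvalue (L s) e) {z : ℕ} (hz : z ≠ 0)
    (hSz : ∀ e ∈ S, e ^ z = 1) {ℓ : ENNReal} (hℓ : 0 < ℓ) :
    ∃ m : ℕ, 1 ≤ m ∧ IsAdiabatic (fun s => L s ^ m) ∧ nonperipheralNorm (fun s => L s ^ m) ≤ ℓ := by
  set ε : ENNReal := min ℓ 2⁻¹
  have hε0 : ε ≠ 0 := (lt_min hℓ (by simp)).ne'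
  have hε1 : ε < 1 := (min_le_right _ _).trans_lt (by simp)
  obtain ⟨k, hk⟩ := ((tendsto_id.const_mul_atTop' (Nat.pos_of_ne_zero hz)).eventually
    (hb.eventually_norm_nonperipheralPart_pow_lt hC2 hL hS h
      (ENNReal.toReal_pos hε0 hε1.ne_top))).exists
  set m : ℕ := z * k + 1
  have hper : ∀ e ∈ S, e ^ m = e := fun e he => by
    rw [pow_succ, pow_mul, hSz e he, one_pow, one_mul]
  have hperL : ∀ s ∈ Icc (0 : ℝ) 1, ∀ e ∈ peripheralSpectrum (L s), e ^ m = e :=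
    fun s hs e he => hper e (hS s hs ▸ he)
  have hm : m ≠ 0 := Nat.succ_ne_zero _
  have hnorm : nonperipheralNorm (fun s => L s ^ m) ≤ ε := iSup₂_le fun s hs => by
    rw [nonperipheralPart_of_pow (hL s hs) hm (hperL s hs), ← ofReal_norm,
      ← ENNReal.ofReal_toReal hε1.ne_top]
    exact ENNReal.ofReal_le_ofReal (hk s hs).le
  refine ⟨m, Nat.pos_of_ne_zero hm, isAdiabatic_of_peripheralSpectrum_eq (S := S) (hC2.pow m)
    (fun s hs => norm_pow_le_one (hL s hs) hm)
    (fun s hs => (peripheralSpectrum_pow hm (hperL s hs)).trans (hS s hs))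
    (fun s hs e he => (h s hs e he).pow (hL s hs) hm (hperL s hs) ((hS s hs).symm ▸ he))
    (hnorm.trans_lt hε1), hnorm.trans (min_le_left _ _)⟩

end Families

section Trace

variable {H : Type*} [NormedAddCommGroup H] [InnerProductSpace ℂ H]

/-- The trace, as a linear functional on the bounded operators. -/
def opTrace : (H →L[ℂ] H) →ₗ[ℂ] ℂ :=
  LinearMap.trace ℂ H ∘ₗ ContinuousLinearMap.coeLM ℂ

theorem opTrace_mul_comm (A B : H →L[ℂ] H) : opTrace (A * B) = opTrace (B * A) :=
  LinearMap.trace_mul_comm ℂ A.toLinearMap B.toLinearMap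

variable [CompleteSpace H] [FiniteDimensional ℂ H]

theorem eq_zero_of_forall_opTrace_mul {W : H →L[ℂ] H} (h : ∀ A, opTrace (W * A) = 0) : W = 0 := by
  obtain ⟨V, -, hV⟩ := exists_contraction_traceNorm W
  have hVW : opTrace (V * W) = 0 := by rw [opTrace_mul_comm, h]
  have hnorm : ‖TraceClass.toOp.symm W‖ = 0 := hV.trans congr(Complex.re $hVW)
  exact TraceClass.toOp.symm.map_eq_zero_iff.1 (norm_eq_zero.1 hnorm)

theorem ext_opTrace_mul {V W : H →L[ℂ] H} (h : ∀ A, opTrace (V * A) = opTrace (W * A)) : V = W :=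
  sub_eq_zero.1 <| eq_zero_of_forall_opTrace_mul fun A => by rw [sub_mul, map_sub, h, sub_self]

theorem exists_forall_eq_opTrace_mul (g : (H →L[ℂ] H) →ₗ[ℂ] ℂ) :
    ∃ W : H →L[ℂ] H, ∀ A, g A = opTrace (W * A) := by
  let pairing : (H →L[ℂ] H) →ₗ[ℂ] Module.Dual ℂ (H →L[ℂ] H) :=
    (LinearMap.mul ℂ (H →L[ℂ] H)).compr₂ opTrace
  have hinj : Function.Injective pairing := (injective_iff_map_eq_zero _).2 fun W hW =>
    eq_zero_of_forall_opTrace_mul fun A => congr($hW A)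
  obtain ⟨W, hW⟩ := (LinearMap.injective_iff_surjective_of_finrank_eq_finrank
    Subspace.dual_finrank_eq.symm).1 hinj g
  exact ⟨W, fun A => congr($hW.symm A)⟩

end Trace

section ChoiKraus

open InnerProductSpace

theorem exists_eq_star_mul_self_of_nonneg {B : Type*} [NonUnitalCStarAlgebra B] [PartialOrder B]
    [StarOrderedRing B] {a : B} (h : 0 ≤ a) : ∃ c, a = star c * c :=
  CStarAlgebra.nonneg_iff_eq_star_mul_self.1 h

variable {H : Type*} [NormedAddCommGroup H] [InnerProductSpace ℂ H] {n : Type*} [Fintype n]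

theorem rankOne_mul_rankOne [DecidableEq n] (b : OrthonormalBasis n ℂ H) (i j k l : n) :
    rankOne ℂ (b i) (b j) * rankOne ℂ (b k) (b l)
      = if j = k then rankOne ℂ (b i) (b l) else 0 := by
  change rankOne ℂ (b i) (b j) ∘L rankOne ℂ (b k) (b l) = _
  rw [rankOne_comp_rankOne, orthonormal_iff_ite.1 b.orthonormal, ite_smul, one_smul, zero_smul]

theorem eq_sum_inner_smul_rankOne (b : OrthonormalBasis n ℂ H) (A : H →L[ℂ] H) :
    A = ∑ i, ∑ j, inner ℂ (b i) (A (b j)) • rankOne ℂ (b i) (b j) := by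
  have hentry : ∀ i j, rankOne ℂ (b i) (b i) * A * rankOne ℂ (b j) (b j)
      = inner ℂ (b i) (A (b j)) • rankOne ℂ (b i) (b j) := fun i j => by
    ext x
    simp [smul_smul, mul_comm]
  have hone : ∑ i, rankOne ℂ (b i) (b i) = 1 := b.sum_rankOne_eq_id
  calc A = (∑ i, rankOne ℂ (b i) (b i)) * A * ∑ j, rankOne ℂ (b j) (b j) := by
        rw [hone, one_mul, mul_one]
    _ = _ := by rw [Finset.sum_mul, Finset.sum_mul_sum]; simp only [hentry]

theorem linearMap_ext_rankOne {E : Type*} [AddCommGroup E] [Module ℂ E]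
    (b : OrthonormalBasis n ℂ H) {φ ψ : (H →L[ℂ] H) →ₗ[ℂ] E}
    (h : ∀ i j, φ (rankOne ℂ (b i) (b j)) = ψ (rankOne ℂ (b i) (b j))) : φ = ψ := by
  ext A
  rw [eq_sum_inner_smul_rankOne b A]
  simp only [map_sum, map_smul, h]

variable [CompleteSpace H]

theorem star_rankOne (x y : H) : star (rankOne ℂ x y) = rankOne ℂ y x :=
  adjoint_rankOne x y

theorem cstarMatrix_rankOne_nonneg (b : OrthonormalBasis n ℂ H) :
    0 ≤ (CStarMatrix.ofMatrix fun i j => rankOne ℂ (b i) (b j) : CStarMatrix n n (H →L[ℂ] H)) := by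
  classical
  cases isEmpty_or_nonempty n
  · exact (CStarMatrix.ext fun i => isEmptyElim i).le
  set M : CStarMatrix n n (H →L[ℂ] H) := CStarMatrix.ofMatrix fun i j => rankOne ℂ (b i) (b j)
  set c : ℝ := (√(Fintype.card n))⁻¹
  have hsq : star M * M = (Fintype.card n : ℝ) • M := by
    ext1 i j
    change ∑ k, star (rankOne ℂ (b k) (b i)) * rankOne ℂ (b k) (b j)
      = (Fintype.card n : ℝ) • rankOne ℂ (b i) (b j)
    simp only [star_rankOne, rankOne_mul_rankOne, if_true, Finset.sum_const, Finset.card_univ,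
      Nat.cast_smul_eq_nsmul]
  have hc : c * c * Fintype.card n = 1 := by
    rw [← mul_inv, Real.mul_self_sqrt (Nat.cast_nonneg _)]
    exact inv_mul_cancel₀ (Nat.cast_ne_zero.2 Fintype.card_ne_zero)
  have hM : M = star (c • M) * (c • M) := by
    rw [star_smul, star_trivial, smul_mul_smul_comm, hsq, smul_smul, hc, one_smul]
  exact hM ▸ star_mul_self_nonneg (c • M)

open CompletelyPositiveMap in
theorem exists_forall_apply_rankOne_eq {A : Type*} [NonUnitalCStarAlgebra A] [PartialOrder A]
    [StarOrderedRing A] (φ : CompletelyPositiveMap (H →L[ℂ] H) A) (b : OrthonormalBasis n ℂ H) :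
    ∃ C : n → n → A, ∀ i j, φ (rankOne ℂ (b i) (b j)) = ∑ k, star (C k i) * C k j := by
  obtain ⟨C, hC⟩ := exists_eq_star_mul_self_of_nonneg
    (map_cstarMatrix_nonneg φ _ (cstarMatrix_rankOne_nonneg b))
  exact ⟨C, fun i j => (congr($hC i j)).trans CStarMatrix.mul_apply⟩

theorem exists_kraus (φ : CompletelyPositiveMap (H →L[ℂ] H) (H →L[ℂ] H))
    (b : OrthonormalBasis n ℂ H) :
    ∃ K : n × n → H →L[ℂ] H, ∀ A, φ A = ∑ p, K p * A * star (K p) := by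
  classical
  obtain ⟨C, hC⟩ := exists_forall_apply_rankOne_eq φ b
  let K : n × n → H →L[ℂ] H := fun p => ∑ i, star (C p.1 i) * rankOne ℂ (b p.2) (b i)
  have hK : ∀ p i, K p * rankOne ℂ (b i) (b p.2)
      = star (C p.1 i) * rankOne ℂ (b p.2) (b p.2) := fun p i => by
    simp [K, Finset.sum_mul, mul_assoc, rankOne_mul_rankOne]
  have hKK : ∀ k l i j, K (k, l) * rankOne ℂ (b i) (b j) * star (K (k, l))
      = star (C k i) * rankOne ℂ (b l) (b l) * C k j := fun k l i j =>
    calc K (k, l) * rankOne ℂ (b i) (b j) * star (K (k, l))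
        = (K (k, l) * rankOne ℂ (b i) (b l)) * star (K (k, l) * rankOne ℂ (b j) (b l)) := by
          rw [star_mul, star_rankOne, ← mul_assoc, mul_assoc (K (k, l)) (rankOne ℂ (b i) (b l)),
            rankOne_mul_rankOne, if_pos rfl]
      _ = star (C k i) * (rankOne ℂ (b l) (b l) * rankOne ℂ (b l) (b l)) * C k j := by
          rw [hK, hK, star_mul, star_star, star_rankOne]
          simp only [mul_assoc]
      _ = star (C k i) * rankOne ℂ (b l) (b l) * C k j := by
          rw [rankOne_mul_rankOne, if_pos rfl]
  have hone : ∑ l, rankOne ℂ (b l) (b l) = 1 := b.sum_rankOne_eq_id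
  have hφ : φ.toLinearMap = ∑ p, LinearMap.mulLeftRight ℂ (K p, star (K p)) := by
    refine linearMap_ext_rankOne b fun i j => (hC i j).trans ?_
    simp only [LinearMap.sum_apply, LinearMap.mulLeftRight_apply, Fintype.sum_prod_type, hKK,
      ← Finset.sum_mul, ← Finset.mul_sum, hone, mul_one]
  exact ⟨K, fun A => (congr($hφ A)).trans (by simp)⟩

end ChoiKraus

section Kraus

variable {H : Type*} [NormedAddCommGroup H] [InnerProductSpace ℂ H] [CompleteSpace H]
  {ι : Type*} [Fintype ι] {K : ι → H →L[ℂ] H}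

/-- The Heisenberg picture of the map `A ↦ ∑ i, K i * A * star (K i)`: its adjoint with respect to
the trace pairing. -/
def krausDual (K : ι → H →L[ℂ] H) (W : H →L[ℂ] H) : H →L[ℂ] H :=
  ∑ i, star (K i) * W * K i

theorem inner_krausDual (K : ι → H →L[ℂ] H) (W : H →L[ℂ] H) (x y : H) :
    inner ℂ x (krausDual K W y) = ∑ i, inner ℂ (K i x) (W (K i y)) := by
  rw [krausDual, sum_apply, inner_sum]
  exact Finset.sum_congr rfl fun i _ =>
    ContinuousLinearMap.adjoint_inner_right (K i) x (W (K i y))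

theorem opTrace_mul_sum_mul_star (K : ι → H →L[ℂ] H) (W A : H →L[ℂ] H) :
    opTrace (W * ∑ i, K i * A * star (K i)) = opTrace (krausDual K W * A) := by
  rw [krausDual, Finset.mul_sum, Finset.sum_mul, map_sum, map_sum]
  refine Finset.sum_congr rfl fun i _ => ?_
  rw [← mul_assoc, opTrace_mul_comm]
  simp only [mul_assoc]

theorem sum_norm_sq_eq (hK : ∑ i, star (K i) * K i = 1) (x : H) :
    ∑ i, ‖K i x‖ ^ 2 = ‖x‖ ^ 2 := by
  have hinner := inner_krausDual K 1 x x
  simp only [krausDual, mul_one, hK, one_apply_eq_self, inner_self_eq_norm_sq_to_K] at hinner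
  exact_mod_cast hinner.symm

theorem norm_krausDual_apply_le (hK : ∑ i, star (K i) * K i = 1) {W : H →L[ℂ] H}
    (hW : ∀ x, ‖W x‖ ≤ ‖x‖) (y : H) : ‖krausDual K W y‖ ≤ ‖y‖ := by
  set v := krausDual K W y
  have hsq : ‖v‖ * ‖v‖ ≤ ‖v‖ * ‖y‖ :=
    calc ‖v‖ * ‖v‖ = ‖∑ i, inner ℂ (K i v) (W (K i y))‖ := by
          rw [← inner_krausDual, inner_self_eq_norm_sq_to_K, sq]; simp [v]
      _ ≤ ∑ i, ‖K i v‖ * ‖K i y‖ := norm_sum_le_of_le _ fun i _ =>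
          (norm_inner_le_norm _ _).trans (by gcongr; exact hW _)
      _ ≤ √(∑ i, ‖K i v‖ ^ 2) * √(∑ i, ‖K i y‖ ^ 2) := Real.sum_mul_le_sqrt_mul_sqrt _ _ _
      _ = ‖v‖ * ‖y‖ := by simp only [sum_norm_sq_eq hK, Real.sqrt_sq (norm_nonneg _)]
  by_contra! hlt
  exact (mul_lt_mul_of_pos_left hlt ((norm_nonneg y).trans_lt hlt)).not_ge hsq

variable [FiniteDimensional ℂ H] {Φ : TraceClass H →L[ℂ] TraceClass H}

/-- The `K i` are Kraus operators of the channel `Φ`. The normalisation `sum_star_mul` is the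
preservation of the trace. -/
structure IsKraus (K : ι → H →L[ℂ] H) (Φ : TraceClass H →L[ℂ] TraceClass H) : Prop where
  apply_eq : ∀ A, (Φ A).toOp = ∑ i, K i * A.toOp * star (K i)
  sum_star_mul : ∑ i, star (K i) * K i = 1

theorem IsKraus.opTrace_mul_apply (h : IsKraus K Φ) (W : H →L[ℂ] H) (A : TraceClass H) :
    opTrace (W * (Φ A).toOp) = opTrace (krausDual K W * A.toOp) := by
  rw [h.apply_eq, opTrace_mul_sum_mul_star]

theorem IsKraus.norm_le_one (h : IsKraus K Φ) : ‖Φ‖ ≤ 1 := by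
  refine Φ.opNorm_le_bound zero_le_one fun A => ?_
  obtain ⟨W, hW, htrace⟩ := exists_contraction_traceNorm (Φ A).toOp
  calc ‖Φ A‖ = (opTrace (W * (Φ A).toOp)).re := htrace
    _ = (opTrace (krausDual K W * A.toOp)).re := by rw [h.opTrace_mul_apply]
    _ ≤ ‖A‖ := re_trace_mul_le_traceNorm _ _ (norm_krausDual_apply_le h.sum_star_mul hW)
    _ = 1 * ‖A‖ := (one_mul _).symm

theorem IsCPTP.exists_isKraus (h : IsCPTP Φ) :
    ∃ K : Fin (Module.finrank ℂ H) × Fin (Module.finrank ℂ H) → H →L[ℂ] H, IsKraus K Φ := by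
  obtain ⟨⟨φ, hφ⟩, htrace⟩ := h
  obtain ⟨K, hK⟩ := exists_kraus φ (stdOrthonormalBasis ℂ H)
  refine ⟨K, fun A => (hφ A).trans (hK _), ext_opTrace_mul fun A => ?_⟩
  calc opTrace ((∑ p, star (K p) * K p) * A) = opTrace (1 * ∑ p, K p * A * star (K p)) := by
        simp only [opTrace_mul_sum_mul_star, krausDual, mul_one]
    _ = opTrace (Φ (TraceClass.toOp.symm A)).toOp := by
        rw [hφ, hK, one_mul, LinearEquiv.apply_symm_apply]
    _ = opTrace (1 * A) := by
        rw [one_mul]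
        exact htrace (TraceClass.toOp.symm A)

end Kraus

section Intertwiners

variable {H : Type*} [NormedAddCommGroup H] [InnerProductSpace ℂ H] {ι : Type*}
  {K : ι → H →L[ℂ] H} {e e' : ℂ} {u v : H →L[ℂ] H}

/-- Irreducibility of a family of operators: the only common invariant subspaces are `0` and the
whole space. -/
def HasNoInvariantSubspace (K : ι → H →L[ℂ] H) : Prop :=
  ∀ M : Submodule ℂ H, (∀ i, ∀ x ∈ M, K i x ∈ M) → M = ⊥ ∨ M = ⊤

/-- `u` commutes with every `K i` up to the common factor `e`. -/
def Intertwines (K : ι → H →L[ℂ] H) (e : ℂ) (u : H →L[ℂ] H) : Prop :=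
  ∀ i, u * K i = e • (K i * u)

namespace Intertwines

theorem one : Intertwines K 1 1 := fun i => by rw [one_mul, mul_one, one_smul]

theorem mul (hu : Intertwines K e u) (hv : Intertwines K e' v) :
    Intertwines K (e * e') (u * v) := fun i =>
  calc u * v * K i = e' • (u * K i * v) := by
        rw [mul_assoc, hv i, mul_smul_comm, ← mul_assoc]
    _ = (e * e') • (K i * (u * v)) := by
        rw [hu i, smul_mul_assoc, smul_smul, mul_comm e', mul_assoc]

theorem sub_smul (hu : Intertwines K e u) (hv : Intertwines K e v) (c : ℂ) :
    Intertwines K e (u - c • v) := fun i => by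
  rw [sub_mul, mul_sub, smul_sub, hu i, smul_mul_assoc, hv i, mul_smul_comm, smul_comm]

theorem isUnit [FiniteDimensional ℂ H] (h : Intertwines K e u) (hK : HasNoInvariantSubspace K)
    (hu : u ≠ 0) : IsUnit u := by
  have hker : ∀ i, ∀ x ∈ u.ker, K i x ∈ u.ker := fun i x hx => by
    have hux : u x = 0 := hx
    change (u * K i) x = 0
    rw [h i, smul_apply, mul_apply_eq_comp, hux, map_zero, smul_zero]
  rcases hK u.ker hker with hbot | htop
  · exact isUnit_of_forall_apply_eq_zero (LinearMap.ker_eq_bot'.1 hbot)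
  · exact absurd (ContinuousLinearMap.ext fun x => LinearMap.mem_ker.1 (htop ▸ trivial : x ∈ u.ker))
      hu

theorem exists_eq_smul [FiniteDimensional ℂ H] [Nontrivial H] (hu : Intertwines K e u)
    (hv : Intertwines K e v) (hK : HasNoInvariantSubspace K) (hu0 : u ≠ 0) :
    ∃ c : ℂ, v = c • u := by
  obtain ⟨w, rfl⟩ := hu.isUnit hK hu0
  have := FiniteDimensional.complete ℂ H
  obtain ⟨c, hc⟩ := spectrum.nonempty (v * ↑w⁻¹ : H →L[ℂ] H)
  have hfactor : v - c • (w : H →L[ℂ] H) = -((algebraMap ℂ _ c - v * ↑w⁻¹) * w) := by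
    rw [sub_mul, Units.inv_mul_cancel_right, neg_sub, Algebra.algebraMap_eq_smul_one,
      smul_mul_assoc, one_mul]
  refine ⟨c, sub_eq_zero.1 (not_not.1 fun hne => spectrum.mem_iff.1 hc ?_)⟩
  have hunit : IsUnit (v - c • (w : H →L[ℂ] H)) := (hv.sub_smul hu c).isUnit hK hne
  rwa [hfactor, IsUnit.neg_iff, Units.isUnit_mul_units] at hunit

end Intertwines

/-- The vectors on which `u` attains its operator norm. By the parallelogram identity they form a
subspace. -/
def normAttainingSubspace (u : H →L[ℂ] H) : Submodule ℂ H where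
  carrier := {x | ‖u x‖ = ‖u‖ * ‖x‖}
  zero_mem' := by simp
  smul_mem' c x hx := by
    change ‖u (c • x)‖ = ‖u‖ * ‖c • x‖
    rw [map_smul, norm_smul, norm_smul, show ‖u x‖ = ‖u‖ * ‖x‖ from hx, mul_left_comm]
  add_mem' {x y} hx hy := by
    have hdiag : ‖u (x + y)‖ ^ 2 + ‖u (x - y)‖ ^ 2
        = (‖u‖ * ‖x + y‖) ^ 2 + (‖u‖ * ‖x - y‖) ^ 2 := by
      change ‖u x‖ = ‖u‖ * ‖x‖ at hx
      change ‖u y‖ = ‖u‖ * ‖y‖ at hy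
      have hxy := parallelogram_law_with_norm ℂ x y
      have huxy := parallelogram_law_with_norm ℂ (u x) (u y)
      rw [hx, hy] at huxy
      rw [map_add, map_sub]
      linear_combination huxy - ‖u‖ ^ 2 * hxy
    have hle : ∀ z, ‖u z‖ ^ 2 ≤ (‖u‖ * ‖z‖) ^ 2 := fun z =>
      pow_le_pow_left₀ (norm_nonneg _) (u.le_opNorm z) 2
    exact (pow_left_inj₀ (norm_nonneg _) (by positivity) two_ne_zero).1
      (by linarith [hle (x + y), hle (x - y)])

theorem mem_normAttainingSubspace_iff {x : H} :
    x ∈ normAttainingSubspace u ↔ ‖u x‖ = ‖u‖ * ‖x‖ := Iff.rfl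

theorem normAttainingSubspace_ne_bot [FiniteDimensional ℂ H] [Nontrivial H] (u : H →L[ℂ] H) :
    normAttainingSubspace u ≠ ⊥ := by
  have := FiniteDimensional.proper ℂ H
  obtain ⟨x, hx, hmax⟩ := (isCompact_sphere (0 : H) 1).exists_isMaxOn
    (NormedSpace.sphere_nonempty.2 zero_le_one) u.continuous.norm.continuousOn
  rw [mem_sphere_zero_iff_norm] at hx
  have hnorm : ‖u‖ ≤ ‖u x‖ := u.opNorm_le_of_unit_norm (norm_nonneg _) fun y hy =>
    hmax (mem_sphere_zero_iff_norm.2 hy)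
  refine (Submodule.ne_bot_iff _).2 ⟨x, ?_, norm_ne_zero_iff.1 (by simp [hx])⟩
  rw [mem_normAttainingSubspace_iff, hx, mul_one]
  exact (u.unit_le_opNorm x hx.le).antisymm hnorm

variable [CompleteSpace H] [Fintype ι]

theorem Intertwines.krausDual_eq (hK : ∑ i, star (K i) * K i = 1) (h : Intertwines K e u) :
    krausDual K u = e • u := by
  simp only [krausDual, mul_assoc, h _, mul_smul_comm]
  simp only [← mul_assoc, ← Finset.smul_sum, ← Finset.sum_mul, hK, one_mul]

theorem sum_norm_smul_sub_sq_of_krausDual_eq (hK : ∑ i, star (K i) * K i = 1) (he : ‖e‖ = 1)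
    (hu : krausDual K u = e • u) (x : H) :
    ∑ i, ‖e • K i (u x) - u (K i x)‖ ^ 2 = ∑ i, ‖u (K i x)‖ ^ 2 - ‖u x‖ ^ 2 := by
  have hcross : ∑ i, inner ℂ (e • K i (u x)) (u (K i x)) = (‖u x‖ ^ 2 : ℝ) := by
    simp only [inner_smul_left, ← Finset.mul_sum]
    rw [← inner_krausDual, hu, smul_apply, inner_smul_right, ← mul_assoc, Complex.conj_mul', he,
      inner_self_eq_norm_sq_to_K]
    simp
  have hre : ∑ i, RCLike.re (inner ℂ (e • K i (u x)) (u (K i x))) = ‖u x‖ ^ 2 := by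
    rw [← map_sum, hcross]
    exact Complex.ofReal_re _
  simp only [@norm_sub_sq ℂ, norm_smul, he, one_mul, Finset.sum_add_distrib,
    Finset.sum_sub_distrib, ← Finset.mul_sum, hre, sum_norm_sq_eq hK]
  ring

theorem sum_norm_apply_sq_of_mem_normAttainingSubspace (hK : ∑ i, star (K i) * K i = 1) {x : H}
    (hx : x ∈ normAttainingSubspace u) : ∑ i, (‖u‖ * ‖K i x‖) ^ 2 = ‖u x‖ ^ 2 := by
  simp only [mul_pow, ← Finset.mul_sum, sum_norm_sq_eq hK]
  rw [mem_normAttainingSubspace_iff.1 hx, mul_pow]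

theorem sum_norm_apply_sq_eq_of_krausDual_eq (hK : ∑ i, star (K i) * K i = 1) (he : ‖e‖ = 1)
    (hu : krausDual K u = e • u) {x : H} (hx : x ∈ normAttainingSubspace u) :
    ∑ i, ‖u (K i x)‖ ^ 2 = ‖u x‖ ^ 2 := by
  have hle : ∑ i, ‖u (K i x)‖ ^ 2 ≤ ∑ i, (‖u‖ * ‖K i x‖) ^ 2 := by
    gcongr with i
    exact u.le_opNorm _
  have hdefect : 0 ≤ ∑ i, ‖e • K i (u x) - u (K i x)‖ ^ 2 := by positivity
  rw [sum_norm_smul_sub_sq_of_krausDual_eq hK he hu, sub_nonneg] at hdefect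
  exact (hle.trans_eq (sum_norm_apply_sq_of_mem_normAttainingSubspace hK hx)).antisymm hdefect

theorem apply_mem_normAttainingSubspace (hK : ∑ i, star (K i) * K i = 1) (he : ‖e‖ = 1)
    (hu : krausDual K u = e • u) {x : H} (hx : x ∈ normAttainingSubspace u) (i : ι) :
    K i x ∈ normAttainingSubspace u := by
  have hle : ∀ j ∈ Finset.univ, ‖u (K j x)‖ ^ 2 ≤ (‖u‖ * ‖K j x‖) ^ 2 := fun j _ =>
    pow_le_pow_left₀ (norm_nonneg _) (u.le_opNorm _) 2
  have hsum : ∑ j, ‖u (K j x)‖ ^ 2 = ∑ j, (‖u‖ * ‖K j x‖) ^ 2 :=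
    (sum_norm_apply_sq_eq_of_krausDual_eq hK he hu hx).trans
      (sum_norm_apply_sq_of_mem_normAttainingSubspace hK hx).symm
  exact (pow_left_inj₀ (norm_nonneg _) (by positivity) two_ne_zero).1
    ((Finset.sum_eq_sum_iff_of_le hle).1 hsum i (Finset.mem_univ i))

theorem smul_apply_eq_of_mem_normAttainingSubspace (hK : ∑ i, star (K i) * K i = 1)
    (he : ‖e‖ = 1) (hu : krausDual K u = e • u) {x : H} (hx : x ∈ normAttainingSubspace u)
    (i : ι) : e • K i (u x) = u (K i x) := by
  have hdefect := sum_norm_smul_sub_sq_of_krausDual_eq hK he hu x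
  rw [sum_norm_apply_sq_eq_of_krausDual_eq hK he hu hx, sub_self,
    Finset.sum_eq_zero_iff_of_nonneg fun _ _ => sq_nonneg _] at hdefect
  exact sub_eq_zero.1 (norm_eq_zero.1 (sq_eq_zero_iff.1 (hdefect i (Finset.mem_univ i))))

theorem intertwines_of_krausDual_eq [FiniteDimensional ℂ H] [Nontrivial H]
    (hK : ∑ i, star (K i) * K i = 1) (hirr : HasNoInvariantSubspace K) (he : ‖e‖ = 1)
    (hu : krausDual K u = e • u) : Intertwines K e u := by
  have htop : normAttainingSubspace u = ⊤ :=
    (hirr _ fun i x hx => apply_mem_normAttainingSubspace hK he hu hx i).resolve_left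
      (normAttainingSubspace_ne_bot u)
  exact fun i => ContinuousLinearMap.ext fun x =>
    (smul_apply_eq_of_mem_normAttainingSubspace hK he hu (htop ▸ trivial) i).symm

end Intertwiners

section Irreducible

variable {H : Type*} [NormedAddCommGroup H] [InnerProductSpace ℂ H] [CompleteSpace H]
  [FiniteDimensional ℂ H] {ι : Type*} [Fintype ι] {K : ι → H →L[ℂ] H} {e e' : ℂ}
  {Φ : TraceClass H →L[ℂ] TraceClass H}

namespace IsKraus

theorem apply_compression_eq (h : IsKraus K Φ) {p : H →L[ℂ] H} (hp : IsSelfAdjoint p)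
    (hKp : ∀ i, p * K i * p = K i * p) (A : H →L[ℂ] H) :
    (Φ (TraceClass.toOp.symm (p * A * p))).toOp
      = p * (Φ (TraceClass.toOp.symm (p * A * p))).toOp * p := by
  have hpK : ∀ i, p * star (K i) * p = p * star (K i) := fun i => by
    simpa [hp.star_eq, mul_assoc] using congr(star $(hKp i))
  rw [h.apply_eq, LinearEquiv.apply_symm_apply, Finset.mul_sum, Finset.sum_mul]
  refine Finset.sum_congr rfl fun i _ => ?_
  calc K i * (p * A * p) * star (K i) = (K i * p) * A * (p * star (K i)) := by
        simp only [mul_assoc]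
    _ = (p * K i * p) * A * (p * star (K i) * p) := by rw [hKp, hpK]
    _ = p * (K i * (p * A * p) * star (K i)) * p := by simp only [mul_assoc]

theorem hasNoInvariantSubspace (h : IsKraus K Φ) (hirr : IsIrreducibleMap Φ) :
    HasNoInvariantSubspace K := fun M hM => by
  have hp : IsStarProjection M.starProjection := isStarProjection_starProjection
  have hKp : ∀ i, M.starProjection * K i * M.starProjection = K i * M.starProjection := fun i =>
    ContinuousLinearMap.ext fun x =>
      Submodule.starProjection_eq_self_iff.2 (hM i _ (M.starProjection_apply_mem x))
  have hmem : ∀ x, x ∈ M ↔ M.starProjection x = x := fun _ =>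
    Submodule.starProjection_eq_self_iff.symm
  refine (hirr _ hp fun A => ⟨_, h.apply_compression_eq hp.isSelfAdjoint hKp A⟩).imp
    (fun h0 => eq_bot_iff.2 fun x hx => ?_) (fun h1 => eq_top_iff.2 fun x _ => ?_)
  · rw [hmem, h0] at hx
    exact hx.symm
  · rw [hmem, h1]
    rfl

theorem opTrace_mul_apply_eq (h : IsKraus K Φ) {u : H →L[ℂ] H} (hu : Intertwines K e u)
    (A : TraceClass H) : opTrace (u * (Φ A).toOp) = e * opTrace (u * A.toOp) := by
  rw [h.opTrace_mul_apply, hu.krausDual_eq h.sum_star_mul, smul_mul_assoc, map_smul, smul_eq_mul]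

variable [Nontrivial H]

theorem exists_intertwines_of_functional (h : IsKraus K Φ) (hirr : IsIrreducibleMap Φ)
    (he : ‖e‖ = 1) {g : TraceClass H →ₗ[ℂ] ℂ} (hg : ∀ A, g (Φ A) = e * g A) :
    ∃ u : H →L[ℂ] H, Intertwines K e u ∧ ∀ A : TraceClass H, g A = opTrace (u * A.toOp) := by
  obtain ⟨u, hu⟩ := exists_forall_eq_opTrace_mul (g ∘ₗ TraceClass.toOp.symm.toLinearMap)
  have hgu : ∀ A : TraceClass H, g A = opTrace (u * A.toOp) := fun A => hu A.toOp
  have hdual : krausDual K u = e • u := ext_opTrace_mul fun A => by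
    have hA := hg (TraceClass.toOp.symm A)
    rw [hgu, hgu, h.opTrace_mul_apply, LinearEquiv.apply_symm_apply] at hA
    rw [hA, smul_mul_assoc, map_smul, smul_eq_mul]
  exact ⟨u, intertwines_of_krausDual_eq h.sum_star_mul (h.hasNoInvariantSubspace hirr) he hdual,
    hgu⟩

theorem mem_peripheralSpectrum_iff (h : IsKraus K Φ) (hirr : IsIrreducibleMap Φ) :
    e ∈ peripheralSpectrum Φ ↔ ‖e‖ = 1 ∧ ∃ u, u ≠ 0 ∧ Intertwines K e u := by
  rw [peripheralSpectrum, mem_inter_iff, mem_spectrum_iff_exists_functional, and_comm,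
    mem_sphere_zero_iff_norm]
  refine and_congr_right fun he => ⟨?_, ?_⟩
  · rintro ⟨g, hg0, hg⟩
    obtain ⟨u, hu, hgu⟩ := h.exists_intertwines_of_functional hirr he hg
    refine ⟨u, ?_, hu⟩
    rintro rfl
    exact hg0 (LinearMap.ext fun A => by rw [hgu, zero_mul, map_zero]; rfl)
  · rintro ⟨u, hu0, hu⟩
    refine ⟨opTrace ∘ₗ LinearMap.mulLeft ℂ u ∘ₗ TraceClass.toOp.toLinearMap,
      fun hzero => hu0 ?_, h.opTrace_mul_apply_eq hu⟩
    exact eq_zero_of_forall_opTrace_mul fun A =>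
      LinearMap.congr_fun hzero (TraceClass.toOp.symm A)

theorem isSimpleEigenvalue (h : IsKraus K Φ) (hirr : IsIrreducibleMap Φ)
    (he : e ∈ peripheralSpectrum Φ) : IsSimpleEigenvalue Φ e := by
  obtain ⟨he1, u, hu0, hu⟩ := (h.mem_peripheralSpectrum_iff hirr).1 he
  refine isSimpleEigenvalue_of_left_eigenspace_le_span
    (isSemisimpleEigenvalue_of_norm_le_one h.norm_le_one he1) he.1
    (opTrace ∘ₗ LinearMap.mulLeft ℂ u ∘ₗ TraceClass.toOp.toLinearMap).toContinuousLinearMap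
    fun g hg => ?_
  obtain ⟨v, hv, hgv⟩ := h.exists_intertwines_of_functional hirr he1 (g := g.toLinearMap) hg
  obtain ⟨c, rfl⟩ := hu.exists_eq_smul hv (h.hasNoInvariantSubspace hirr) hu0
  refine ⟨c, ContinuousLinearMap.ext fun A => (hgv A).trans ?_⟩
  rw [smul_mul_assoc, map_smul]
  rfl

theorem one_mem_peripheralSpectrum (h : IsKraus K Φ) (hirr : IsIrreducibleMap Φ) :
    1 ∈ peripheralSpectrum Φ :=
  (h.mem_peripheralSpectrum_iff hirr).2 ⟨norm_one, 1, one_ne_zero, Intertwines.one⟩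

theorem mul_mem_peripheralSpectrum (h : IsKraus K Φ) (hirr : IsIrreducibleMap Φ)
    (he : e ∈ peripheralSpectrum Φ) (he' : e' ∈ peripheralSpectrum Φ) :
    e * e' ∈ peripheralSpectrum Φ := by
  obtain ⟨he1, u, hu0, hu⟩ := (h.mem_peripheralSpectrum_iff hirr).1 he
  obtain ⟨he1', v, hv0, hv⟩ := (h.mem_peripheralSpectrum_iff hirr).1 he'
  have hunit := hu.isUnit (h.hasNoInvariantSubspace hirr) hu0
  exact (h.mem_peripheralSpectrum_iff hirr).2
    ⟨by rw [norm_mul, he1, he1', one_mul], u * v, fun h0 => hv0 (hunit.mul_right_eq_zero.1 h0),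
      hu.mul hv⟩

end IsKraus

end Irreducible

section UnitRoots

theorem mem_unitRoots_iff {z : ℕ} (hz : z ≠ 0) {w : ℂ} : w ∈ unitRoots z ↔ w ^ z = 1 := by
  have hz' : (z : ℂ) ≠ 0 := Nat.cast_ne_zero.2 hz
  have : NeZero z := ⟨hz⟩
  constructor
  · rintro ⟨k, -, rfl⟩
    rw [← Complex.exp_nat_mul, Complex.exp_eq_one_iff]
    exact ⟨k, by push_cast; field_simp⟩
  · intro hw
    obtain ⟨k, hk, rfl⟩ :=
      (Complex.isPrimitiveRoot_exp z hz).eq_pow_of_pow_eq_one hw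
    exact ⟨k, hk, by rw [← Complex.exp_nat_mul]; congr 1; ring⟩

theorem pow_card_eq_one_of_mul_mem {S : Finset ℂ} (h0 : 0 ∉ S)
    (hmul : ∀ a ∈ S, ∀ b ∈ S, a * b ∈ S) {a : ℂ} (ha : a ∈ S) : a ^ S.card = 1 := by
  have ha0 : a ≠ 0 := ne_of_mem_of_not_mem ha h0
  have himg : S.image (a * ·) = S :=
    Finset.eq_of_subset_of_card_le (Finset.image_subset_iff.2 (hmul a ha))
      (Finset.card_image_of_injective S (mul_right_injective₀ ha0)).ge
  have hprod : a ^ S.card * ∏ b ∈ S, b = ∏ b ∈ S, b := by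
    conv_rhs => rw [← himg, Finset.prod_image (mul_right_injective₀ ha0).injOn,
      Finset.prod_mul_distrib, Finset.prod_const]
  exact (mul_eq_right₀ (Finset.prod_ne_zero_iff.2 fun b hb => ne_of_mem_of_not_mem hb h0)).1 hprod

theorem coe_eq_unitRoots_card_of_mul_mem {S : Finset ℂ} (hne : S.Nonempty) (h0 : 0 ∉ S)
    (hmul : ∀ a ∈ S, ∀ b ∈ S, a * b ∈ S) : (S : Set ℂ) = unitRoots S.card := by
  have hS : S = Polynomial.nthRootsFinset S.card (1 : ℂ) :=
    Finset.eq_of_subset_of_card_le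
      (fun a ha => (Polynomial.mem_nthRootsFinset hne.card_pos 1).2
        (pow_card_eq_one_of_mul_mem h0 hmul ha))
      ((Multiset.toFinset_card_le _).trans (Polynomial.card_nthRoots _ _))
  ext a
  rw [mem_unitRoots_iff hne.card_pos.ne', ← Polynomial.mem_nthRootsFinset hne.card_pos, ← hS,
    Finset.mem_coe]

end UnitRoots

section Channels

variable {H : Type*} [NormedAddCommGroup H] [InnerProductSpace ℂ H] [CompleteSpace H]
  [FiniteDimensional ℂ H]

theorem IsCPTP.norm_le_one {Φ : TraceClass H →L[ℂ] TraceClass H} (h : IsCPTP Φ) : ‖Φ‖ ≤ 1 :=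
  h.exists_isKraus.elim fun _ hK => hK.norm_le_one

variable [Nontrivial H]

theorem IsCPTP.isSimpleEigenvalue {Φ : TraceClass H →L[ℂ] TraceClass H} (h : IsCPTP Φ)
    (hirr : IsIrreducibleMap Φ) {e : ℂ} (he : e ∈ peripheralSpectrum Φ) :
    IsSimpleEigenvalue Φ e :=
  h.exists_isKraus.elim fun _ hK => hK.isSimpleEigenvalue hirr he

theorem IsCPTP.peripheralSpectrum_eq_unitRoots {Φ : TraceClass H →L[ℂ] TraceClass H}
    (h : IsCPTP Φ) (hirr : IsIrreducibleMap Φ) :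
    peripheralSpectrum Φ = unitRoots (peripheralSpectrum Φ).ncard := by
  obtain ⟨K, hK⟩ := h.exists_isKraus
  lift peripheralSpectrum Φ to Finset ℂ using finite_peripheralSpectrum Φ with S hS
  have hmem : ∀ e, e ∈ S ↔ e ∈ peripheralSpectrum Φ := fun e => by rw [← hS, Finset.mem_coe]
  rw [ncard_coe_finset]
  refine coe_eq_unitRoots_card_of_mul_mem ⟨1, (hmem 1).2 (hK.one_mem_peripheralSpectrum hirr)⟩
    (fun h0 => ?_) fun a ha b hb => ?_
  · simpa using norm_eq_one_of_mem_peripheralSpectrum ((hmem 0).1 h0)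
  · rw [hmem] at ha hb ⊢
    exact hK.mul_mem_peripheralSpectrum hirr ha hb

theorem IsCPTP.ncard_peripheralSpectrum_pos {Φ : TraceClass H →L[ℂ] TraceClass H}
    (h : IsCPTP Φ) (hirr : IsIrreducibleMap Φ) : 0 < (peripheralSpectrum Φ).ncard :=
  h.exists_isKraus.elim fun _ hK =>
    (ncard_pos (finite_peripheralSpectrum Φ)).2 ⟨1, hK.one_mem_peripheralSpectrum hirr⟩

theorem IsCPTP.peripheralSpectrum_subset_unitRoots {Φ : TraceClass H →L[ℂ] TraceClass H}
    (h : IsCPTP Φ) (hirr : IsIrreducibleMap Φ) :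
    peripheralSpectrum Φ ⊆ unitRoots (Module.finrank ℂ (TraceClass H)).factorial := fun e he => by
  have hpos := h.ncard_peripheralSpectrum_pos hirr
  rw [h.peripheralSpectrum_eq_unitRoots hirr, mem_unitRoots_iff hpos.ne'] at he
  exact (mem_unitRoots_iff (Nat.factorial_ne_zero _)).2
    (orderOf_dvd_iff_pow_eq_one.1 ((orderOf_dvd_of_pow_eq_one he).trans
      (Nat.dvd_factorial hpos (ncard_peripheralSpectrum_le Φ))))

theorem finite_unitRoots (z : ℕ) : (unitRoots z).Finite :=
  ((finite_Iio z).image fun k : ℕ => Complex.exp (2 * Complex.I * Real.pi * k / z)).subset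
    fun _ ⟨k, hk, hw⟩ => ⟨k, hk, hw.symm⟩

variable {L : ℝ → TraceClass H →L[ℂ] TraceClass H}

theorem HasSpectralBound.exists_peripheralSpectrum_eq_unitRoots (hb : HasSpectralBound L)
    (hcont : ContinuousOn L (Icc 0 1))
    (hL : ∀ s ∈ Icc (0 : ℝ) 1, IsCPTP (L s) ∧ IsIrreducibleMap (L s)) :
    ∃ z : ℕ, 1 ≤ z ∧ ∀ s ∈ Icc (0 : ℝ) 1, peripheralSpectrum (L s) = unitRoots z := by
  have h0 : (0 : ℝ) ∈ Icc (0 : ℝ) 1 := left_mem_Icc.2 zero_le_one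
  obtain ⟨hcptp, hirr⟩ := hL 0 h0
  refine ⟨_, hcptp.ncard_peripheralSpectrum_pos hirr, fun s hs => ?_⟩
  rw [← hcptp.peripheralSpectrum_eq_unitRoots hirr]
  exact hb.peripheralSpectrum_eq (fun s hs => (hL s hs).1.norm_le_one) hcont (finite_unitRoots _)
    (fun s hs => (hL s hs).1.peripheralSpectrum_subset_unitRoots (hL s hs).2) hs h0

end Channels

theorem proposition6p1_general {H : Type*} [NormedAddCommGroup H] [InnerProductSpace ℂ H]
    [CompleteSpace H] [FiniteDimensional ℂ H] [Nontrivial H]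
    (L : ℝ → TraceClass H →L[ℂ] TraceClass H) (hC2 : IsC2 L)
    (hL : ∀ s ∈ Set.Icc (0 : ℝ) 1, IsCPTP (L s) ∧ IsIrreducibleMap (L s)) :
    (HasNormBound L → IsAdiabatic L) ∧
    (HasSpectralBound L → ∀ ℓ : ENNReal, 0 < ℓ →
      ∃ m : ℕ, 1 ≤ m ∧ IsAdiabatic (fun s => L s ^ m) ∧
        nonperipheralNorm (fun s => L s ^ m) ≤ ℓ) ∧
    (HasNormBound L ∨ HasSpectralBound L →
      ∃ z : ℕ, 1 ≤ z ∧ ∀ s ∈ Set.Icc (0 : ℝ) 1, peripheralSpectrum (L s) = unitRoots z) := by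
  have hcontr : IsContractive L := fun s hs => (hL s hs).1.norm_le_one
  have hroots (hb : HasSpectralBound L) := hb.exists_peripheralSpectrum_eq_unitRoots
    (ContDiffOn.continuousOn hC2) hL
  have hsimple {z : ℕ} (hz : ∀ s ∈ Icc (0 : ℝ) 1, peripheralSpectrum (L s) = unitRoots z) :
      ∀ s ∈ Icc (0 : ℝ) 1, ∀ e ∈ unitRoots z, IsSimpleEigenvalue (L s) e := fun s hs e he =>
    (hL s hs).1.isSimpleEigenvalue (hL s hs).2 ((hz s hs).symm ▸ he)
  refine ⟨fun hb => ?_, fun hb ℓ hℓ => ?_, fun hb => hroots (hb.elim (·.hasSpectralBound) id)⟩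
  · obtain ⟨z, -, hz⟩ := hroots hb.hasSpectralBound
    exact isAdiabatic_of_peripheralSpectrum_eq hC2 hcontr hz (hsimple hz) hb
  · obtain ⟨z, hz1, hz⟩ := hroots hb
    exact hb.exists_isAdiabatic_pow hC2 hcontr hz (hsimple hz) (Nat.one_le_iff_ne_zero.1 hz1)
      (fun e => (mem_unitRoots_iff (Nat.one_le_iff_ne_zero.1 hz1)).1) hℓ

end

theorem proposition6p1 {H : Type*} [NormedAddCommGroup H] [InnerProductSpace ℂ H]
    [CompleteSpace H] [FiniteDimensional ℂ H] [Nontrivial H]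
    (L : ℝ → TraceClass H →L[ℂ] TraceClass H) (hC2 : IsC2 L)
    (hL : ∀ s ∈ Set.Icc (0 : ℝ) 1, IsCPTP (L s) ∧ IsIrreducibleMap (L s)) :
    (HasNormBound L → IsAdiabatic L) ∧
    (HasSpectralBound L → ∀ ℓ : ENNReal, nonperipheralSpectralRadius L < ℓ → ℓ < 1 →
      ∃ m : ℕ, 1 ≤ m ∧ IsAdiabatic (fun s => L s ^ m) ∧
        nonperipheralNorm (fun s => L s ^ m) ≤ ℓ) ∧
    (HasNormBound L ∨ HasSpectralBound L →
      ∃ z : ℕ, 1 ≤ z ∧ ∀ s ∈ Set.Icc (0 : ℝ) 1, peripheralSpectrum (L s) = unitRoots z) := by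
  obtain ⟨hnorm, hpow, hroots⟩ := proposition6p1_general L hC2 hL
  exact ⟨hnorm, fun hb ℓ hℓ _ => hpow hb ℓ (pos_of_gt hℓ), hroots⟩
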